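/- Let $\mathscr G$ be an undirected weighted graph on $n$ vertices (loops allowed): a symmetric edge set $\mathscr E\subseteq\{1,\dots,n\}^2$ and a symmetric, entrywise non-negative weight matrix $W\in\mathbb R^{n\times n}$ vanishing outside $\mathscr E$. For a symmetric matrix $A$ put $L(A)=\mathrm{diag}(A\mathbb 1)-A$, where $\mathbb 1=(1,\dots,1)^T$, and denote the eigenvalues of $L(A)$ by $\lambda_1\le\dots\le\lambda_n$. Let $\langle A,B\rangle=\mathrm{trace}(A^TB)$ and let $\|\cdot\|_F$ be the Frobenius norm. Let $\mathcal S$ be the space of real $n\times n$ matrices vanishing outside $\mathscr E$, $\Pi_{\mathcal S}$ the orthogonal projection onto $\mathcal S$, and $\mathcal E_1=\{E\in\mathcal S: E=E^T,\ \|E\|_F=1\}$. Fix $\varepsilon>0$ and an integer $k$ with $2\le k\le n-1$. For symmetric $E$ let $F_\varepsilon(E)=\lambda_{k+1}(L(W+\varepsilon E))-\lambda_k(L(W+\varepsilon E))$, let $x,y$ be unit eigenvectors of $L(W+\varepsilon E)$ for $\lambda_{k+1}$ and $\lambda_k$ respectively, let $z$ be the vector with entries $z_i=x_i^2-y_i^2$,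 and $$R_\varepsilon(E)=\tfrac12\,(z\mathbb 1^T+\mathbb 1z^T)-xx^T+yy^T,$$ which is well defined when $\lambda_k$ and $\lambda_{k+1}$ are simple. Let $\mathcal M_4$ be the manifold of real $n\times n$ matrices of rank $4$ and, for $Y\in\mathcal M_4$, let $P_Y$ be the orthogonal projection (for $\langle\cdot,\cdot\rangle$) onto the tangent space of $\mathcal M_4$ at $Y$. Consider, on the symmetric matrices of $\mathcal M_4$, the equation $$\dot Y=-P_YR_\varepsilon(E)+\langle P_YR_\varepsilon(E),E\rangle\,Y,\qquad E=\Pi_{\mathcal S}Y.\tag{$*$}$$ **Theorem.** Let $Y_\star\in\mathcal M_4$ be symmetric and a stationary point of $(*)$ such that $E_\star=\Pi_{\mathcal S}Y_\star$ has $\|E_\star\|_F=1$, the eigenvalues $\lambda_k$ and $\lambda_{k+1}$ of $L(W+\varepsilon E_\star)$ are simple, and $P_{Y_\star}R_\varepsilon(E_\star)\ne0$. Suppose that $E_\star$ is a strong local minimum of $F_\varepsilon$ on $\mathcal E_1$, i.e. there are $\alpha,r>0$ with $F_\varepsilon(E)\ge F_\varepsilon(E_\star)+\alpha\|E-E_\star\|_F^2$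 for all $E\in\mathcal E_1$ with $\|E-E_\star\|_F<r$. Suppose further that, for some open neighbourhood $U$ of $Y_\star$ in $\mathbb R^{n\times n}$ (for instance $U=\mathbb R^{n\times n}$), $\Pi_{\mathcal S}$ restricts to a diffeomorphism of $\mathcal M_4\cap U$ onto its image. Then there are constants $\delta,C,c>0$ such that for every symmetric $Y_0\in\mathcal M_4$ with $\|\Pi_{\mathcal S}Y_0\|_F=1$ and $\|Y_0-Y_\star\|_F<\delta$, the equation $(*)$ has a solution on $[0,\infty)$ with $Y(0)=Y_0$, and every such solution satisfies 1. $\|Y(t)-Y_\star\|_F\le C e^{-ct}$ for all $t\ge0$; 2. $t\mapsto F_\varepsilon(\Pi_{\mathcal S}Y(t))$ is non-increasing on $[0,\infty)$; 3. $|F_\varepsilon(\Pi_{\mathcal S}Y(t))-F_\varepsilon(E_\star)|\le C e^{-ct}$ for all $t\ge0$. -/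

import Mathlib

open Set

noncomputable section

namespace LowRankFlow

/- Matrices carry the Frobenius norm throughout. -/
attribute [local instance] Matrix.frobeniusNormedAddCommGroup Matrix.frobeniusNormedSpace

/-- An undirected weighted graph on the vertices `0, …, n - 1`: a symmetric edge set (loops are
allowed) and a symmetric nonnegative weight matrix supported on the edges. -/
structure WeightedGraph (n : ℕ) where
  edges : Set (Fin n × Fin n)
  edges_symm : ∀ i j, (i, j) ∈ edges → (j, i) ∈ edges
  weight : Matrix (Fin n) (Fin n) ℝ
  weight_symm : weight.IsSymm
  weight_nonneg : ∀ i j, 0 ≤ weight i j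
  weight_eq_zero : ∀ i j, (i, j) ∉ edges → weight i j = 0

/-- The Frobenius inner product `⟨A, B⟩ = trace (Aᵀ B)`. -/
def frobInner {n : ℕ} (A B : Matrix (Fin n) (Fin n) ℝ) : ℝ := (A.transpose * B).trace

/-- The graph Laplacian `L(W) = diag(W 𝟙) - W`. -/
def laplacian {n : ℕ} (W : Matrix (Fin n) (Fin n) ℝ) : Matrix (Fin n) (Fin n) ℝ :=
  Matrix.diagonal (W.mulVec 1) - W

open scoped Classical in
/-- The `j`-th smallest eigenvalue `λ_j(A)`, `1 ≤ j ≤ n`, counted with multiplicity, of a real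
symmetric matrix. (Mathlib's `eigenvalues₀` is in decreasing order; the value is `0` when `A` is not
symmetric or `j` is out of range.) -/
def eigval {n : ℕ} (A : Matrix (Fin n) (Fin n) ℝ) (j : ℕ) : ℝ :=
  if h : A.IsHermitian ∧ 1 ≤ j ∧ j ≤ n then
    h.1.eigenvalues₀ ⟨n - j, by rw [Fintype.card_fin]; omega⟩
  else 0

/-- For a symmetric matrix and `1 ≤ j ≤ n` there is a unit eigenvector for `λ_j`. -/
theorem exists_unit_eigenvector {n : ℕ} {A : Matrix (Fin n) (Fin n) ℝ} (hA : A.IsHermitian)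
    {j : ℕ} (h1 : 1 ≤ j) (hn : j ≤ n) :
    ∃ v : Fin n → ℝ, v ⬝ᵥ v = 1 ∧ A.mulVec v = eigval A j • v := by
  have hlt : n - j < Fintype.card (Fin n) := by rw [Fintype.card_fin]; omega
  let e : Fin (Fintype.card (Fin n)) ≃ Fin n := Fintype.equivOfCardEq (Fintype.card_fin _)
  refine ⟨hA.eigenvectorBasis (e ⟨n - j, hlt⟩), ?_, ?_⟩
  · have h := hA.eigenvectorBasis.orthonormal.1 (e ⟨n - j, hlt⟩)
    rw [EuclideanSpace.norm_eq, Real.sqrt_eq_one] at h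
    rw [← h]
    simp [dotProduct, sq]
  · rw [hA.mulVec_eigenvectorBasis]
    congr 1
    simp only [eigval, hA, h1, hn, and_self, dif_pos, Matrix.IsHermitian.eigenvalues]
    congr 1
    exact e.symm_apply_apply _

open scoped Classical in
/-- A unit eigenvector `x_j(A)` for `λ_j(A)`; it is unique up to sign when `λ_j(A)` is simple. -/
def eigvec {n : ℕ} (A : Matrix (Fin n) (Fin n) ℝ) (j : ℕ) : Fin n → ℝ :=
  if h : ∃ v : Fin n → ℝ, v ⬝ᵥ v = 1 ∧ A.mulVec v = eigval A j • v then h.choose else 0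

/-- `λ_j(A)` is a simple eigenvalue of the (symmetric) matrix `A`. -/
def IsSimpleEigval {n : ℕ} (A : Matrix (Fin n) (Fin n) ℝ) (j : ℕ) : Prop :=
  Module.finrank ℝ (Module.End.eigenspace (Matrix.toLin' A) (eigval A j)) = 1

/-- The symmetric matrices of rank `4`, i.e. `M₄ ∩ Sym`. -/
def symRankFour (n : ℕ) : Set (Matrix (Fin n) (Fin n) ℝ) := {Y | Y.rank = 4 ∧ Y.IsSymm}

/-- The matrix of the orthogonal projection of `ℝⁿ` onto the range of `Y`. -/
def rangeProj {n : ℕ} (Y : Matrix (Fin n) (Fin n) ℝ) : Matrix (Fin n) (Fin n) ℝ :=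
  Matrix.toEuclideanLin.symm
    (LinearMap.range (Matrix.toEuclideanLin Y)).starProjection.toLinearMap

/-- The projection `P_Y A = A - (I - V₁V₁ᵀ) A (I - V₂V₂ᵀ)` onto the tangent space at `Y` of the
manifold of matrices of the same rank as `Y`, where `Y = V₁ΣV₂ᵀ` is a (reduced) singular value
decomposition, so that `V₁V₁ᵀ` and `V₂V₂ᵀ` are the orthogonal projections onto the ranges of `Y` and
`Yᵀ`. -/
def tangentProj {n : ℕ} (Y A : Matrix (Fin n) (Fin n) ℝ) : Matrix (Fin n) (Fin n) ℝ :=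
  A - (1 - rangeProj Y) * A * (1 - rangeProj Y.transpose)

theorem rangeProj_mul_self {n : ℕ} (Y : Matrix (Fin n) (Fin n) ℝ) : rangeProj Y * Y = Y := by
  apply Matrix.toEuclideanLin.injective
  ext1 v
  have h : Matrix.toEuclideanLin (rangeProj Y * Y) v
      = Matrix.toEuclideanLin (rangeProj Y) (Matrix.toEuclideanLin Y v) := by
    simp [Matrix.toLpLin_apply, Matrix.mulVec_mulVec]
  rw [h, rangeProj, LinearEquiv.apply_symm_apply]
  exact Submodule.starProjection_eq_self_iff.2 (LinearMap.mem_range_self _ v)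

theorem rangeProj_transpose {n : ℕ} (Y : Matrix (Fin n) (Fin n) ℝ) :
    (rangeProj Y).transpose = rangeProj Y := by
  have h : (rangeProj Y).IsHermitian := by
    rw [← Matrix.isSymmetric_toEuclideanLin_iff, rangeProj, LinearEquiv.apply_symm_apply]
    exact (LinearMap.range (Matrix.toEuclideanLin Y)).starProjection_isSymmetric
  simpa [Matrix.IsHermitian, Matrix.conjTranspose_eq_transpose_of_trivial] using h

theorem exists_rangeProj_eq_mul {n : ℕ} (Y : Matrix (Fin n) (Fin n) ℝ) :
    ∃ X, rangeProj Y = Y * X := by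
  have h : ∀ j, ∃ w : Fin n → ℝ, Y.mulVec w = (rangeProj Y).mulVec (Pi.single j 1) := by
    intro j
    have hm : Matrix.toEuclideanLin (rangeProj Y) (WithLp.toLp 2 (Pi.single j 1)) ∈
        LinearMap.range (Matrix.toEuclideanLin Y) := by
      rw [rangeProj, LinearEquiv.apply_symm_apply]
      exact Submodule.starProjection_apply_mem _ _
    obtain ⟨w, hw⟩ := hm
    refine ⟨w.ofLp, ?_⟩
    simpa [Matrix.toLpLin_apply] using hw
  choose w hw using h
  refine ⟨Matrix.of fun i j => w j i, ?_⟩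
  ext i j
  have := congrFun (hw j) i
  rw [Matrix.mulVec_single_one] at this
  exact this.symm

/-- `tangentProj Y A` lies in the tangent space `{Y B + C Y}` at `Y`. -/
theorem tangentProj_mem {n : ℕ} (Y A : Matrix (Fin n) (Fin n) ℝ) :
    ∃ B C, tangentProj Y A = Y * B + C * Y := by
  obtain ⟨X, hX⟩ := exists_rangeProj_eq_mul Y
  obtain ⟨Z, hZ⟩ := exists_rangeProj_eq_mul Y.transpose
  have hZ' : rangeProj Y.transpose = Z.transpose * Y := by
    rw [← rangeProj_transpose, hZ, Matrix.transpose_mul, Matrix.transpose_transpose]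
  refine ⟨X * A, (1 - rangeProj Y) * A * Z.transpose, ?_⟩
  rw [Matrix.mul_assoc _ Z.transpose, ← hZ', ← Matrix.mul_assoc Y, ← hX, tangentProj]
  noncomm_ring

/-- `A - tangentProj Y A` is orthogonal to the tangent space `{Y B + C Y}` at `Y`. -/
theorem frobInner_sub_tangentProj {n : ℕ} (Y A B C : Matrix (Fin n) (Fin n) ℝ) :
    frobInner (A - tangentProj Y A) (Y * B + C * Y) = 0 := by
  have h1 : (1 - rangeProj Y) * Y = 0 := by rw [sub_mul, one_mul, rangeProj_mul_self, sub_self]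
  have h2 : Y * (1 - rangeProj Y.transpose) = 0 := by
    have := congrArg Matrix.transpose (rangeProj_mul_self Y.transpose)
    rw [Matrix.transpose_mul, rangeProj_transpose, Matrix.transpose_transpose] at this
    rw [mul_sub, mul_one, this, sub_self]
  have h3 : (A - tangentProj Y A).transpose
      = (1 - rangeProj Y.transpose) * (A.transpose * (1 - rangeProj Y)) := by
    simp [tangentProj, Matrix.transpose_mul, rangeProj_transpose]
  rw [frobInner, h3, mul_add, Matrix.trace_add]
  have e1 : (1 - rangeProj Y.transpose) * (A.transpose * (1 - rangeProj Y)) * (Y * B) = 0 := by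
    rw [Matrix.mul_assoc, Matrix.mul_assoc, ← Matrix.mul_assoc _ Y, h1]; simp
  rw [e1, Matrix.trace_mul_comm, ← Matrix.mul_assoc, Matrix.mul_assoc C, h2]
  simp

/-- `f` is smooth on the subset `X`: near each point of `X` it extends to a smooth map defined on an
open set. -/
def SmoothOnSubset {V : Type*} [NormedAddCommGroup V] [NormedSpace ℝ V] (f : V → V) (X : Set V) :
    Prop :=
  ∀ x ∈ X, ∃ (O : Set V) (g : V → V), IsOpen O ∧ x ∈ O ∧ ContDiffOn ℝ (⊤ : ℕ∞) g O ∧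
    ∀ y ∈ X ∩ O, g y = f y

/-- `f` restricts to a diffeomorphism from `X` onto its image `f(X)`. -/
def IsDiffeoOntoImage {V : Type*} [NormedAddCommGroup V] [NormedSpace ℝ V] (f : V → V)
    (X : Set V) : Prop :=
  SmoothOnSubset f X ∧ ∃ g : V → V, SmoothOnSubset g (f '' X) ∧ LeftInvOn g f X

/-- `x` is a strong local minimum of `F` on `X`: the function grows at least quadratically around
`x` on `X`. -/
def IsStrongLocalMinOn {V : Type*} [NormedAddCommGroup V] (F : V → ℝ) (X : Set V) (x : V) : Prop :=
  x ∈ X ∧ ∃ α > 0, ∃ r > 0, ∀ y ∈ X, ‖y - x‖ < r → F x + α * ‖y - x‖ ^ 2 ≤ F y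

namespace WeightedGraph

variable {n : ℕ} (G : WeightedGraph n)

open scoped Classical in
/-- The orthogonal projection `Π_S` onto the matrices that vanish outside the edge set. -/
def patProj (A : Matrix (Fin n) (Fin n) ℝ) : Matrix (Fin n) (Fin n) ℝ :=
  Matrix.of fun i j => if (i, j) ∈ G.edges then A i j else 0

/-- The symmetric matrices of unit Frobenius norm that vanish outside the edge set. -/
def unitSphere : Set (Matrix (Fin n) (Fin n) ℝ) :=
  {E | E.IsSymm ∧ (∀ i j, (i, j) ∉ G.edges → E i j = 0) ∧ ‖E‖ = 1}

/-- `L(W + ε E)`. -/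
def lap (ε : ℝ) (E : Matrix (Fin n) (Fin n) ℝ) : Matrix (Fin n) (Fin n) ℝ :=
  laplacian (G.weight + ε • E)

/-- The functional `F_ε(E) = λ_{k+1}(L(W + ε E)) - λ_k(L(W + ε E))`. -/
def gap (k : ℕ) (ε : ℝ) (E : Matrix (Fin n) (Fin n) ℝ) : ℝ :=
  eigval (G.lap ε E) (k + 1) - eigval (G.lap ε E) k

/-- `R_ε(E) = (z 𝟙ᵀ + 𝟙 zᵀ) / 2 - x xᵀ + y yᵀ`, where `x`, `y` are unit eigenvectors of
`L(W + ε E)` for `λ_{k+1}`, `λ_k` and `z = x • x - y • y` (componentwise products). -/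
def R (k : ℕ) (ε : ℝ) (E : Matrix (Fin n) (Fin n) ℝ) : Matrix (Fin n) (Fin n) ℝ :=
  let x := eigvec (G.lap ε E) (k + 1)
  let y := eigvec (G.lap ε E) k
  let z := x * x - y * y
  (2⁻¹ : ℝ) • (Matrix.vecMulVec z 1 + Matrix.vecMulVec 1 z)
    - Matrix.vecMulVec x x + Matrix.vecMulVec y y

/-- The right-hand side `-P_Y R_ε(E) + ⟨P_Y R_ε(E), E⟩ Y`, `E = Π_S Y`, of the low-rank equation. -/
def lowRankField (k : ℕ) (ε : ℝ) (Y : Matrix (Fin n) (Fin n) ℝ) : Matrix (Fin n) (Fin n) ℝ :=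
  let E := G.patProj Y
  frobInner (tangentProj Y (G.R k ε E)) E • Y - tangentProj Y (G.R k ε E)

/-- `Y` is a solution on `[0, ∞)` of the low-rank equation in the symmetric rank-4 matrices. -/
def IsLowRankSolution (k : ℕ) (ε : ℝ) (Y : ℝ → Matrix (Fin n) (Fin n) ℝ) : Prop :=
  ∀ t, 0 ≤ t → Y t ∈ symRankFour n ∧
    HasDerivWithinAt Y (G.lowRankField k ε (Y t)) (Ici 0) t

end WeightedGraph

end LowRankFlow

end

attribute [local instance] Matrix.frobeniusNormedAddCommGroup Matrix.frobeniusNormedSpace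

/-!
On symmetric matrices `Π_S` is the orthogonal projection onto the Euclidean space of symmetric
matrices supported on the edges, and there `ε Π_S R(E)` is the gradient of the gap `F`. Stationarity
at `Y⋆` together with `rank R ≤ 4` forces `R(E⋆) = μ Y⋆` with `μ ≠ 0`. Hence near `Y⋆` both `Y` and
`μ⁻¹ R(E)` have rank at most four and lie close to each other; since `R - P_Y R` contains two
factors that compare their ranges, it is quadratically small in `Y - Y⋆`. As `Π_S` has a Lipschitz
inverse at `Y⋆`, `E = Π_S Y` follows the gradient flow of `F` on the unit sphere up to an error
`o(‖E - E⋆‖)`. The strong minimum makes the spherical gradient strictly monotone at `E⋆`, so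
`‖E - E⋆‖` decays exponentially, and with it `‖Y - Y⋆‖` and the excess of `F`.

For existence, the vector field has near `Y⋆` the form `C(Y) Y + Y C(Y)ᵀ` with `C` continuously
differentiable. Such a field is tangent to the closed set of symmetric matrices of rank at most
four, which is therefore invariant by Nagumo's theorem; lower semicontinuity of the rank excludes
smaller ranks near `Y⋆`.
-/

open Filter Topology

namespace LowRankFlow

section Calculus

variable {E F G : Type*} [NormedAddCommGroup E] [NormedSpace ℝ E] [NormedAddCommGroup F]
  [NormedSpace ℝ F] [NormedAddCommGroup G] [NormedSpace ℝ G]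

theorem hasFDerivAt_of_sub_eq_clm_apply_sub {f : E → F} {g : E → G} {g' : E →L[ℝ] G}
    {Φ : E → G →L[ℝ] F} {p : E} (hg : HasFDerivAt g g' p) (hΦ : ContinuousAt Φ p)
    (hfg : ∀ᶠ q in 𝓝 p, f q - f p = Φ q (g q - g p)) : HasFDerivAt f ((Φ p).comp g') p := by
  have hslope : (fun q => (Φ q - Φ p) (g q - g p)) =o[𝓝 p] fun q => q - p := by
    have hΦ0 : (fun q => ‖Φ q - Φ p‖) =o[𝓝 p] fun _ => (1 : ℝ) := by
      rw [Asymptotics.isLittleO_one_iff]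
      exact tendsto_iff_norm_sub_tendsto_zero.1 hΦ
    refine Asymptotics.IsBigO.trans_isLittleO ?_
      (by simpa using hΦ0.mul_isBigO hg.isBigO_sub.norm_norm) |>.trans_isBigO
      (Asymptotics.isBigO_refl _ _).norm_left
    exact Asymptotics.isBigO_of_le _ fun q => by
      simpa using (Φ q - Φ p).le_opNorm (g q - g p)
  have hlin : (fun q => Φ p (g q - g p - g' (q - p))) =o[𝓝 p] fun q => q - p :=
    ((Φ p).isBigO_comp _ _).trans_isLittleO hg.isLittleO
  refine HasFDerivAt.of_isLittleO ((hslope.add hlin).congr' ?_ EventuallyEq.rfl)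
  filter_upwards [hfg] with q hq
  simp [hq]

theorem norm_sub_taylor_two_le {f : E → F} {f' : E → E →L[ℝ] F} {L : E →L[ℝ] E →L[ℝ] F}
    {x e : E} {η : ℝ} (hf : ∀ w ∈ segment ℝ e x, HasFDerivAt f (f' w) w)
    (hf' : ∀ w ∈ segment ℝ e x, ‖f' w - f' e - L (w - e)‖ ≤ η * ‖x - e‖) :
    ‖f x - f e - f' e (x - e) - (2⁻¹ : ℝ) • L (x - e) (x - e)‖ ≤ η * ‖x - e‖ ^ 2 := by
  set D := x - e with hD
  have hseg : ∀ s ∈ Icc (0 : ℝ) 1, e + s • D ∈ segment ℝ e x := fun s hs => by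
    rw [segment_eq_image']
    exact ⟨s, hs, rfl⟩
  have hder : ∀ s ∈ Icc (0 : ℝ) 1, HasDerivWithinAt
      (fun s : ℝ => f (e + s • D) - s • f' e D - (s ^ 2 / 2) • L D D)
      ((f' (e + s • D) - f' e - L (e + s • D - e)) D) (Icc 0 1) s := by
    intro s hs
    have hline : HasDerivAt (fun s : ℝ => e + s • D) D s := by
      simpa using ((hasDerivAt_id s).smul_const D).const_add e
    have hquad := (((hasDerivAt_id s).pow 2).div_const 2).smul_const (L D D)
    refine ((((hf _ (hseg s hs)).comp_hasDerivAt s hline).sub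
      ((hasDerivAt_id s).smul_const (f' e D))).sub hquad |>.congr_deriv ?_).hasDerivWithinAt
    simp
  have hbound : ∀ s ∈ Ico (0 : ℝ) 1,
      ‖(f' (e + s • D) - f' e - L (e + s • D - e)) D‖ ≤ η * ‖D‖ ^ 2 := fun s hs => by
    refine (ContinuousLinearMap.le_of_opNorm_le _ (hf' _ (hseg s ⟨hs.1, hs.2.le⟩)) D).trans_eq ?_
    ring
  convert norm_image_sub_le_of_norm_deriv_le_segment_01' hder hbound using 2
  simp only [hD, one_smul, add_sub_cancel, zero_smul, add_zero]
  module

/-- The second derivative cancels in the trapezoidal rule. -/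
theorem sub_sub_trapezoid_isLittleO {f : E → F} {f' : E → E →L[ℝ] F}
    {f'' : E →L[ℝ] E →L[ℝ] F} {e : E} (hf : ∀ᶠ x in 𝓝 e, HasFDerivAt f (f' x) x)
    (hf' : HasFDerivAt f' f'' e) :
    (fun x => f x - f e - (2⁻¹ : ℝ) • (f' x + f' e) (x - e)) =o[𝓝 e] fun x => ‖x - e‖ ^ 2 := by
  refine Asymptotics.isLittleO_iff.2 fun c hc => ?_
  have hrem : ∀ᶠ x in 𝓝 e, ‖f' x - f' e - f'' (x - e)‖ ≤ c / 2 * ‖x - e‖ :=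
    hf'.isLittleO.def (half_pos hc)
  obtain ⟨ρ, hρ, hball⟩ := Metric.eventually_nhds_iff_ball.1 (hf.and hrem)
  filter_upwards [Metric.ball_mem_nhds e hρ] with x hx
  have hseg : ∀ w ∈ segment ℝ e x, w ∈ Metric.ball e ρ := fun w hw =>
    (convex_ball e ρ).segment_subset (Metric.mem_ball_self hρ) hx hw
  have htaylor := norm_sub_taylor_two_le (fun w hw => (hball w (hseg w hw)).1) fun w hw =>
    (hball w (hseg w hw)).2.trans
      (mul_le_mul_of_nonneg_left (norm_sub_le_of_mem_segment hw) (half_pos hc).le)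
  have hrx := ContinuousLinearMap.le_of_opNorm_le _ (hball x hx).2 (x - e)
  calc ‖f x - f e - (2⁻¹ : ℝ) • (f' x + f' e) (x - e)‖
      = ‖(f x - f e - f' e (x - e) - (2⁻¹ : ℝ) • f'' (x - e) (x - e))
          - (2⁻¹ : ℝ) • (f' x - f' e - f'' (x - e)) (x - e)‖ := by
        congr 1
        simp only [add_apply, sub_apply]
        module
    _ ≤ c / 2 * ‖x - e‖ ^ 2 + 2⁻¹ * (c / 2 * ‖x - e‖ * ‖x - e‖) := by
        refine (norm_sub_le _ _).trans (add_le_add htaylor ?_)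
        rw [norm_smul, Real.norm_of_nonneg (by norm_num)]
        gcongr
    _ ≤ c * ‖‖x - e‖ ^ 2‖ := by
        rw [Real.norm_of_nonneg (by positivity)]
        nlinarith [mul_nonneg hc.le (sq_nonneg ‖x - e‖)]

end Calculus

section Sphere

variable {H : Type*} [NormedAddCommGroup H] [InnerProductSpace ℝ H]

theorem real_inner_self_sub_of_norm_eq {x e : H} (h : ‖x‖ = ‖e‖) :
    inner ℝ x (x - e) = ‖x - e‖ ^ 2 / 2 := by
  rw [norm_sub_sq_real, inner_sub_right, real_inner_self_eq_norm_sq, h]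
  ring

theorem starProjection_orthogonal_span_singleton {u : H} (hu : ‖u‖ = 1) (w : H) :
    (ℝ ∙ u)ᗮ.starProjection w = w - inner ℝ w u • u := by
  rw [Submodule.starProjection_orthogonal', sub_apply,
    Submodule.starProjection_unit_singleton ℝ hu, real_inner_comm]
  rfl

theorem inner_tangential_gradient_sub_isLittleO {f : H → ℝ} {γ : H → H} {γ' : H →L[ℝ] H}
    {e : H} {ν : ℝ} (hf : ∀ᶠ x in 𝓝 e, HasFDerivAt f (innerSL ℝ (γ x)) x)
    (hγ : HasFDerivAt γ γ' e) (he : ‖e‖ = 1) (hγe : γ e = ν • e) :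
    (fun x => inner ℝ (γ x - inner ℝ (γ x) x • x) (x - e) - 2 * (f x - f e))
      =o[𝓝[Metric.sphere 0 1] e] fun x => ‖x - e‖ ^ 2 := by
  have htrap := sub_sub_trapezoid_isLittleO hf ((innerSL ℝ).hasFDerivAt.comp e hγ)
  have hmult : (fun x => ν - inner ℝ (γ x) x) =o[𝓝 e] fun _ => (1 : ℝ) := by
    rw [Asymptotics.isLittleO_one_iff]
    have hcont : ContinuousAt (fun x => ν - inner ℝ (γ x) x) e :=
      continuousAt_const.sub (hγ.continuousAt.inner continuousAt_id)
    simpa [hγe, real_inner_smul_left, he] using hcont.tendsto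
  have hmult' := hmult.mul_isBigO (Asymptotics.isBigO_refl (fun x => ‖x - e‖ ^ 2) (𝓝 e))
  simp only [one_mul] at hmult'
  refine (((htrap.const_mul_left (-2)).add (hmult'.const_mul_left 2⁻¹)).mono
    nhdsWithin_le_nhds).congr' ?_ EventuallyEq.rfl
  filter_upwards [self_mem_nhdsWithin] with x hx
  have hxe : ‖x‖ = ‖e‖ := by rw [he]; simpa using hx
  have hxD := real_inner_self_sub_of_norm_eq hxe
  have heD : inner ℝ e (x - e) = -(‖x - e‖ ^ 2 / 2) := by
    rw [← neg_sub e x, inner_neg_right, real_inner_self_sub_of_norm_eq hxe.symm, norm_neg]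
  simp only [add_apply, innerSL_apply_apply, inner_sub_left,
    real_inner_smul_left, smul_eq_mul, hxD, hγe, heD]
  ring

theorem exists_le_inner_tangential_gradient {f : H → ℝ} {g : H → H} {g' : H →L[ℝ] H} {e : H}
    {ε ν : ℝ} (hε : 0 < ε) (hf : ∀ᶠ x in 𝓝 e, HasFDerivAt f (ε • innerSL ℝ (g x)) x)
    (hg : HasFDerivAt g g' e) (hge : g e = ν • e)
    (hmin : IsStrongLocalMinOn f (Metric.sphere 0 1) e) :
    ∃ c > 0, ∀ᶠ x in 𝓝[Metric.sphere 0 1] e,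
      c * ‖x - e‖ ^ 2 ≤ inner ℝ (g x - inner ℝ (g x) x • x) (x - e) := by
  obtain ⟨he, α, hα, r, hr, hgrowth⟩ := hmin
  refine ⟨α / ε, div_pos hα hε, ?_⟩
  have hsmall := inner_tangential_gradient_sub_isLittleO (γ := fun x => ε • g x) (ν := ε * ν)
    (by simpa only [map_smul] using hf) (hg.const_smul ε) (by simpa using he)
    (by rw [hge, smul_smul]) |>.def hα
  filter_upwards [hsmall, self_mem_nhdsWithin,
    mem_nhdsWithin_of_mem_nhds (Metric.ball_mem_nhds e hr)] with x hx hx1 hxr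
  have hfx := hgrowth x hx1 (by rwa [← dist_eq_norm])
  rw [Real.norm_of_nonneg (sq_nonneg ‖x - e‖), real_inner_smul_left, mul_smul, ← smul_sub,
    real_inner_smul_left] at hx
  rw [div_mul_eq_mul_div, div_le_iff₀' hε]
  linarith [(abs_le.1 hx).1]

theorem inner_tangential_sub_le_of_norm_sub_le {u D ρ τ : H} {c : ℝ} (hu : ‖u‖ = 1)
    (hρ : c * ‖D‖ ^ 2 ≤ inner ℝ (ρ - inner ℝ ρ u • u) D) (hτ : ‖ρ - τ‖ ≤ c / 2 * ‖D‖) :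
    inner ℝ (inner ℝ τ u • u - τ) D ≤ -(c / 2) * ‖D‖ ^ 2 := by
  rw [← neg_sub τ, inner_neg_left]
  rw [← starProjection_orthogonal_span_singleton hu] at hρ ⊢
  set T := (ℝ ∙ u)ᗮ.starProjection
  have hdiff : inner ℝ (T (ρ - τ)) D ≤ c / 2 * ‖D‖ ^ 2 :=
    calc inner ℝ (T (ρ - τ)) D ≤ ‖T (ρ - τ)‖ * ‖D‖ := real_inner_le_norm _ _
      _ ≤ c / 2 * ‖D‖ * ‖D‖ := by
        gcongr
        exact ((ℝ ∙ u)ᗮ.norm_starProjection_apply_le _).trans hτ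
      _ = c / 2 * ‖D‖ ^ 2 := by ring
  rw [map_sub, inner_sub_left] at hdiff
  linarith

theorem inner_tangential_nonpos_of_norm_sub_le {u D ρ τ : H} {c : ℝ} (hu : ‖u‖ = 1)
    (hρ : c * ‖D‖ ^ 2 ≤ inner ℝ (ρ - inner ℝ ρ u • u) D) (hτ : ‖ρ - τ‖ ≤ c * ‖D‖) :
    inner ℝ ρ (inner ℝ τ u • u - τ) ≤ 0 := by
  rw [← neg_sub τ, inner_neg_right, neg_nonpos]
  rw [← starProjection_orthogonal_span_singleton hu] at hρ ⊢
  set T := (ℝ ∙ u)ᗮ.starProjection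
  have hlower : ‖T (ρ - τ)‖ ≤ ‖T ρ‖ := by
    refine ((ℝ ∙ u)ᗮ.norm_starProjection_apply_le _).trans (hτ.trans ?_)
    rcases (norm_nonneg D).eq_or_lt with hD | hD
    · simp [← hD]
    · refine le_of_mul_le_mul_right (le_trans (le_of_eq ?_) (hρ.trans (real_inner_le_norm _ _))) hD
      ring
  have hTT : inner ℝ ρ (T τ) = inner ℝ (T ρ) (T τ) := by
    rw [Submodule.inner_starProjection_left_eq_right,
      Submodule.starProjection_eq_self_iff.2 (Submodule.starProjection_apply_mem _ _)]
  calc 0 ≤ ‖T ρ‖ * ‖T ρ‖ - ‖T ρ‖ * ‖T (ρ - τ)‖ := by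
        rw [sub_nonneg]; gcongr
    _ ≤ inner ℝ (T ρ) (T ρ) - inner ℝ (T ρ) (T (ρ - τ)) := by
        rw [real_inner_self_eq_norm_mul_norm]
        gcongr
        exact real_inner_le_norm _ _
    _ = inner ℝ ρ (T τ) := by rw [hTT, ← inner_sub_right, ← map_sub, sub_sub_cancel]

end Sphere

section Attraction

variable {V H : Type*} [NormedAddCommGroup V] [NormedSpace ℝ V] [NormedAddCommGroup H]
  [InnerProductSpace ℝ H]

theorem norm_eq_one_of_abs_inner_deriv_le {x x' : ℝ → H} {a b K : ℝ}
    (hx : ContinuousOn x (Icc a b)) (hx' : ∀ t ∈ Ico a b, HasDerivWithinAt x (x' t) (Ici t) t)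
    (hK : ∀ t ∈ Ico a b, |inner ℝ (x' t) (x t)| ≤ K * |‖x t‖ ^ 2 - 1|) (ha : ‖x a‖ = 1) :
    ∀ t ∈ Icc a b, ‖x t‖ = 1 := by
  intro t ht
  have hzero : ‖x t‖ ^ 2 - 1 = 0 := by
    refine eq_zero_of_abs_deriv_le_mul_abs_self_of_eq_zero_right (K := 2 * K)
      ((hx.norm.pow 2).sub continuousOn_const) (fun s hs => ((hx' s hs).norm_sq).sub_const 1)
      (by simp [ha]) (fun s hs => ?_) t ht
    rw [norm_mul, Real.norm_ofNat, real_inner_comm, Real.norm_eq_abs, Real.norm_eq_abs, mul_assoc]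
    exact mul_le_mul_of_nonneg_left (hK s hs) zero_le_two
  exact (pow_eq_one_iff_of_nonneg (norm_nonneg _) two_ne_zero).1 (sub_eq_zero.1 hzero)

theorem norm_sub_le_mul_exp_of_inner_deriv_le {x x' : ℝ → H} {a b c : ℝ} {e : H}
    (hx : ContinuousOn x (Icc a b)) (hx' : ∀ t ∈ Ico a b, HasDerivWithinAt x (x' t) (Ici t) t)
    (hc : ∀ t ∈ Ico a b, inner ℝ (x' t) (x t - e) ≤ -c * ‖x t - e‖ ^ 2) :
    ∀ t ∈ Icc a b, ‖x t - e‖ ≤ ‖x a - e‖ * Real.exp (-c * (t - a)) := by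
  intro t ht
  have hgronwall : ‖x t - e‖ ^ 2 ≤ gronwallBound (‖x a - e‖ ^ 2) (-2 * c) 0 (t - a) := by
    refine le_gronwallBound_of_liminf_deriv_right_le (f := fun t => ‖x t - e‖ ^ 2)
      ((hx.sub continuousOn_const).norm.pow 2)
      (fun s hs r hr => (((hx' s hs).sub_const e).norm_sq).liminf_right_slope_le hr) le_rfl
      (fun s hs => ?_) t ht
    rw [real_inner_comm]
    linarith [hc s hs]
  rw [gronwallBound_ε0] at hgronwall
  refine le_of_sq_le_sq (hgronwall.trans_eq ?_) (by positivity)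
  rw [mul_pow, ← Real.exp_nat_mul]
  congr 2
  push_cast
  ring

theorem forall_lt_of_bootstrap {φ : ℝ → ℝ} {ρ : ℝ} (hφ : ContinuousOn φ (Ici 0))
    (h : ∀ T, 0 ≤ T → (∀ t ∈ Ico 0 T, φ t < ρ) → φ T < ρ) : ∀ t, 0 ≤ t → φ t < ρ := by
  intro t ht
  by_contra! hcon
  have hcompact : IsCompact {s ∈ Icc 0 t | ρ ≤ φ s} :=
    isCompact_Icc.of_isClosed_subset ((hφ.mono Icc_subset_Ici_self).preimage_isClosed_of_isClosed
      isClosed_Icc isClosed_Ici) fun _ hs => hs.1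
  obtain ⟨T, hT, hmin⟩ := hcompact.exists_isLeast ⟨t, ⟨ht, le_rfl⟩, hcon⟩
  refine absurd (h T hT.1.1 fun s hs => ?_) (not_lt.2 hT.2)
  by_contra! hle
  exact absurd (hmin ⟨⟨hs.1, hs.2.le.trans hT.1.2⟩, hle⟩) (not_le.2 hs.2)

/-- `Y` is a curve in `[0, ∞)` which stays in `M` and solves `Y' = v(Y)` at all times at which it
lies in `B`. Cutting the field off outside `B` produces such curves. -/
def IsSolutionWhileIn (v : V → V) (M B : Set V) (Y : ℝ → V) : Prop :=
  ContinuousOn Y (Ici 0) ∧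
    ∀ t, 0 ≤ t → Y t ∈ B → Y t ∈ M ∧ HasDerivWithinAt Y (v (Y t)) (Ici 0) t

theorem IsSolutionWhileIn.mono {v : V → V} {M B B' : Set V} {Y : ℝ → V}
    (hY : IsSolutionWhileIn v M B Y) (hB : B' ⊆ B) : IsSolutionWhileIn v M B' Y :=
  ⟨hY.1, fun t ht hB' => hY.2 t ht (hB hB')⟩

/-- At the point `Y`, the image under `P` of the field `v` is tangent to the unit sphere up to an
error of the order of the distance to it, attracts `P Y` to `P z` at rate `c` along the sphere, and
`P` separates `Y` from `z`. -/
structure IsSphericallyAttracted (P : V →L[ℝ] H) (v : V → V) (z : V) (K L c : ℝ) (Y : V) :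
    Prop where
  abs_inner_le : |inner ℝ (P (v Y)) (P Y)| ≤ K * |‖P Y‖ ^ 2 - 1|
  norm_sub_le : ‖Y - z‖ ≤ L * ‖P Y - P z‖
  inner_le : ‖P Y‖ = 1 → inner ℝ (P (v Y)) (P Y - P z) ≤ -c * ‖P Y - P z‖ ^ 2

variable {P : V →L[ℝ] H} {v : V → V} {M : Set V} {z : V} {K L c ρ : ℝ} {Y : ℝ → V}

theorem IsSolutionWhileIn.norm_map_sub_le_of_mem_ball
    (hattr : ∀ X ∈ M ∩ Metric.ball z ρ, IsSphericallyAttracted P v z K L c X)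
    (hY : IsSolutionWhileIn v M (Metric.ball z ρ) Y) (h0 : ‖P (Y 0)‖ = 1) {T : ℝ}
    (hT : ∀ t ∈ Ico 0 T, Y t ∈ Metric.ball z ρ) {t : ℝ} (ht : t ∈ Icc 0 T) :
    ‖P (Y t)‖ = 1 ∧ ‖P (Y t) - P z‖ ≤ ‖P (Y 0) - P z‖ * Real.exp (-c * t) := by
  have hcont : ContinuousOn (fun t => P (Y t)) (Icc 0 T) :=
    P.continuous.comp_continuousOn (hY.1.mono Icc_subset_Ici_self)
  have hderiv : ∀ t ∈ Ico 0 T, HasDerivWithinAt (fun t => P (Y t)) (P (v (Y t))) (Ici t) t :=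
    fun t ht => P.hasFDerivAt.comp_hasDerivWithinAt t
      ((hY.2 t ht.1 (hT t ht)).2.mono (Ici_subset_Ici.2 ht.1))
  have hattrY : ∀ t ∈ Ico 0 T, IsSphericallyAttracted P v z K L c (Y t) := fun t ht =>
    hattr _ ⟨(hY.2 t ht.1 (hT t ht)).1, hT t ht⟩
  have hunit := norm_eq_one_of_abs_inner_deriv_le hcont hderiv
    (fun t ht => (hattrY t ht).abs_inner_le) h0
  have hdecay := norm_sub_le_mul_exp_of_inner_deriv_le hcont hderiv
    (fun t ht => (hattrY t ht).inner_le (hunit t (Ico_subset_Icc_self ht))) t ht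
  exact ⟨hunit t ht, by simpa only [sub_zero] using hdecay⟩

theorem IsSolutionWhileIn.mem_ball (hL : 0 ≤ L) (hc : 0 ≤ c)
    (hattr : ∀ X ∈ M ∩ Metric.ball z ρ, IsSphericallyAttracted P v z K L c X)
    (hY : IsSolutionWhileIn v M (Metric.ball z ρ) Y) (h0 : ‖P (Y 0)‖ = 1)
    (h0ρ : Y 0 ∈ Metric.ball z ρ) (h0P : L * ‖P (Y 0) - P z‖ < ρ) :
    ∀ t, 0 ≤ t → Y t ∈ Metric.ball z ρ := by
  simp only [mem_ball_iff_norm] at h0ρ ⊢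
  have hcont : ContinuousOn (fun t => ‖Y t - z‖) (Ici 0) := (hY.1.sub continuousOn_const).norm
  refine forall_lt_of_bootstrap hcont fun T hT hlt => ?_
  rcases hT.eq_or_lt with rfl | hT0
  · exact h0ρ
  have hle : ∀ t ∈ Ico 0 T, ‖Y t - z‖ ≤ L * ‖P (Y 0) - P z‖ := by
    intro t ht
    have htρ : ∀ s ∈ Ico 0 T, Y s ∈ Metric.ball z ρ := fun s hs => mem_ball_iff_norm.2 (hlt s hs)
    refine (hattr _ ⟨(hY.2 t ht.1 (htρ t ht)).1, htρ t ht⟩).norm_sub_le.trans ?_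
    refine mul_le_mul_of_nonneg_left ((hY.norm_map_sub_le_of_mem_ball hattr h0 htρ
      (Ico_subset_Icc_self ht)).2.trans (mul_le_of_le_one_right (norm_nonneg _) ?_)) hL
    exact Real.exp_le_one_iff.2 (mul_nonpos_of_nonpos_of_nonneg (neg_nonpos.2 hc) ht.1)
  have hclosure : closure (Ico 0 T) = Icc 0 T := closure_Ico hT0.ne
  refine (le_on_closure hle (hclosure ▸ hcont.mono Icc_subset_Ici_self) continuousOn_const
    ?_).trans_lt h0P
  exact hclosure ▸ right_mem_Icc.2 hT

theorem IsSolutionWhileIn.antitoneOn_comp {f : H → ℝ} {f' : H → H →L[ℝ] ℝ} {B : Set V}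
    (hY : IsSolutionWhileIn v M B Y) (hB : ∀ t, 0 ≤ t → Y t ∈ B)
    (hf : ∀ t, 0 ≤ t → HasFDerivAt f (f' (P (Y t))) (P (Y t)))
    (hdesc : ∀ t, 0 ≤ t → f' (P (Y t)) (P (v (Y t))) ≤ 0) :
    AntitoneOn (fun t => f (P (Y t))) (Ici 0) := by
  have hderiv : ∀ t, 0 ≤ t → HasDerivWithinAt (fun t => f (P (Y t)))
      (f' (P (Y t)) (P (v (Y t)))) (Ici 0) t := fun t ht =>
    (hf t ht).comp_hasDerivWithinAt t
      (P.hasFDerivAt.comp_hasDerivWithinAt t (hY.2 t ht (hB t ht)).2)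
  refine antitoneOn_of_hasDerivWithinAt_nonpos (convex_Ici 0)
    (fun t ht => (hderiv t ht).continuousWithinAt)
    (fun t ht => (hderiv t (interior_subset ht)).mono interior_subset)
    (fun t ht => hdesc t (interior_subset ht))

theorem exists_eventually_exponential_decay {f : H → ℝ} {f' : H → H →L[ℝ] ℝ} (hL : 0 ≤ L)
    (hc : 0 ≤ c) (hattr : ∀ᶠ X in 𝓝[M] z, IsSphericallyAttracted P v z K L c X)
    (hf : ∀ᶠ x in 𝓝 (P z), HasFDerivAt f (f' x) x)
    (hdesc : ∀ᶠ X in 𝓝[M] z, ‖P X‖ = 1 → f' (P X) (P (v X)) ≤ 0) {U : Set V} (hU : U ∈ 𝓝 z) :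
    ∃ C > 0, ∀ᶠ X in 𝓝 z, ‖P X‖ = 1 → ∀ Y, IsSolutionWhileIn v M U Y → Y 0 = X →
      (∀ t, 0 ≤ t → Y t ∈ U) ∧ (∀ t, 0 ≤ t → ‖Y t - z‖ ≤ C * Real.exp (-c * t)) ∧
      AntitoneOn (fun t => f (P (Y t))) (Ici 0) ∧
      ∀ t, 0 ≤ t → |f (P (Y t)) - f (P z)| ≤ C * Real.exp (-c * t) := by
  obtain ⟨B, hB, hfB⟩ := hf.self_of_nhds.isBigO_sub.exists_pos
  have hgood : ∀ᶠ X in 𝓝 z, (X ∈ M → IsSphericallyAttracted P v z K L c X ∧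
      (‖P X‖ = 1 → f' (P X) (P (v X)) ≤ 0)) ∧ X ∈ U ∧ HasFDerivAt f (f' (P X)) (P X) ∧
      |f (P X) - f (P z)| ≤ B * ‖P X - P z‖ :=
    (eventually_nhdsWithin_iff.1 (hattr.and hdesc)).and <| (eventually_mem_set.2 hU).and <|
      P.continuous.continuousAt.eventually (hf.and hfB.bound)
  obtain ⟨ρ, hρ, hball⟩ := Metric.eventually_nhds_iff_ball.1 hgood
  have hstart : Tendsto (fun X => ‖P X - P z‖) (𝓝 z) (𝓝 0) := by
    have h : Continuous fun X => ‖P X - P z‖ := by fun_prop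
    simpa using h.tendsto z
  have hstartL : Tendsto (fun X => L * ‖P X - P z‖) (𝓝 z) (𝓝 0) := by
    simpa using hstart.const_mul L
  refine ⟨L + B, by positivity, ?_⟩
  filter_upwards [Metric.ball_mem_nhds z hρ, hstart.eventually_lt_const one_pos,
    hstartL.eventually_lt_const hρ]
    with X hXρ hX1 hXL hXn Y hY hYX
  subst hYX
  replace hY := hY.mono fun X hX => (hball X hX).2.1
  have hattrB : ∀ X ∈ M ∩ Metric.ball z ρ, IsSphericallyAttracted P v z K L c X :=
    fun X hX => ((hball X hX.2).1 hX.1).1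
  have hmem := hY.mem_ball hL hc hattrB hXn hXρ hXL
  have hdecay : ∀ t, 0 ≤ t → ‖P (Y t)‖ = 1 ∧ ‖P (Y t) - P z‖ ≤ Real.exp (-c * t) := fun t ht => by
    have h := hY.norm_map_sub_le_of_mem_ball hattrB hXn (fun s hs => hmem s hs.1)
      (right_mem_Icc.2 ht)
    exact ⟨h.1, h.2.trans (mul_le_of_le_one_left (Real.exp_pos _).le hX1.le)⟩
  have hscale : ∀ {A a t : ℝ}, 0 ≤ t → A ≤ L + B → a ≤ A * ‖P (Y t) - P z‖ →
      a ≤ (L + B) * Real.exp (-c * t) := fun ht hAC ha =>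
    ha.trans (mul_le_mul hAC (hdecay _ ht).2 (norm_nonneg _) (by positivity))
  refine ⟨fun t ht => (hball _ (hmem t ht)).2.1, fun t ht => ?_, ?_, fun t ht => ?_⟩
  · exact hscale ht (by linarith)
      (hattrB _ ⟨(hY.2 t ht (hmem t ht)).1, hmem t ht⟩).norm_sub_le
  · exact hY.antitoneOn_comp hmem (fun t ht => (hball _ (hmem t ht)).2.2.1) fun t ht =>
      ((hball _ (hmem t ht)).1 (hY.2 t ht (hmem t ht)).1).2 (hdecay t ht).1
  · exact hscale ht (by linarith) (hball _ (hmem t ht)).2.2.2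

end Attraction

section PerturbedGradientFlow

variable {V H : Type*} [NormedAddCommGroup V] [NormedSpace ℝ V] [NormedAddCommGroup H]
  [InnerProductSpace ℝ H] {P : V →L[ℝ] H} {v : V → V} {M : Set V} {z : V} {f : H → ℝ} {g : H → H}
  {g' : H →L[ℝ] H} {τ : V → H} {ε ν c : ℝ}

theorem tendsto_of_sub_isLittleO (hg : ContinuousAt g (P z))
    (hτ : (fun Y => g (P Y) - τ Y) =o[𝓝[M] z] fun Y => P Y - P z) :
    Tendsto τ (𝓝[M] z) (𝓝 (g (P z))) := by
  have hP : Tendsto (fun Y => P Y - P z) (𝓝[M] z) (𝓝 0) := by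
    have h : Continuous fun Y => P Y - P z := by fun_prop
    simpa using (h.tendsto z).mono_left nhdsWithin_le_nhds
  have hgP : Tendsto (fun Y => g (P Y)) (𝓝[M] z) (𝓝 (g (P z))) :=
    (hg.tendsto.comp (P.continuous.tendsto z)).mono_left nhdsWithin_le_nhds
  simpa using hgP.sub (hτ.isBigO.trans_tendsto hP)

theorem exists_eventually_isSphericallyAttracted (hc : 0 < c)
    (hv : ∀ᶠ Y in 𝓝[M] z, P (v Y) = inner ℝ (τ Y) (P Y) • P Y - τ Y)
    (hg : ContinuousAt g (P z)) (hτ : (fun Y => g (P Y) - τ Y) =o[𝓝[M] z] fun Y => P Y - P z)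
    (hP : (fun Y => Y - z) =O[𝓝[M] z] fun Y => P Y - P z)
    (hgrad : ∀ᶠ x in 𝓝[Metric.sphere 0 1] (P z),
      c * ‖x - P z‖ ^ 2 ≤ inner ℝ (g x - inner ℝ (g x) x • x) (x - P z)) :
    ∃ K, ∃ L ≥ 0, ∀ᶠ Y in 𝓝[M] z, IsSphericallyAttracted P v z K L (c / 2) Y ∧
      (‖P Y‖ = 1 → inner ℝ (g (P Y)) (P (v Y)) ≤ 0) := by
  obtain ⟨L, hL, hPL⟩ := hP.exists_nonneg
  have hPM : Tendsto P (𝓝[M] z) (𝓝 (P z)) := (P.continuous.tendsto z).mono_left nhdsWithin_le_nhds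
  have hbound : ∀ᶠ Y in 𝓝[M] z, |inner ℝ (τ Y) (P Y)| < |inner ℝ (g (P z)) (P z)| + 1 :=
    ((tendsto_of_sub_isLittleO hg hτ).inner hPM).abs.eventually_lt_const (lt_add_one _)
  have hgradP := hPM.eventually (eventually_nhdsWithin_iff.1 hgrad)
  refine ⟨|inner ℝ (g (P z)) (P z)| + 1, L, hL, ?_⟩
  filter_upwards [hv, hPL.bound, hbound, hgradP, hτ.def (half_pos hc)]
    with Y hvY hLY hbY hgY hτY
  refine ⟨⟨?_, hLY, fun hu => ?_⟩, fun hu => ?_⟩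
  · have hradial : inner ℝ (P (v Y)) (P Y) = inner ℝ (τ Y) (P Y) * (‖P Y‖ ^ 2 - 1) := by
      rw [hvY, inner_sub_left, real_inner_smul_left, real_inner_self_eq_norm_sq]
      ring
    rw [hradial, abs_mul]
    gcongr
  · rw [hvY]
    exact inner_tangential_sub_le_of_norm_sub_le hu (hgY (by simpa using hu)) hτY
  · rw [hvY]
    refine inner_tangential_nonpos_of_norm_sub_le hu (hgY (by simpa using hu)) (hτY.trans ?_)
    gcongr
    linarith

theorem exists_exponential_decay_of_isStrongLocalMinOn (hε : 0 < ε)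
    (hv : ∀ᶠ Y in 𝓝[M] z, P (v Y) = inner ℝ (τ Y) (P Y) • P Y - τ Y)
    (hτ : (fun Y => g (P Y) - τ Y) =o[𝓝[M] z] fun Y => P Y - P z)
    (hP : (fun Y => Y - z) =O[𝓝[M] z] fun Y => P Y - P z)
    (hf : ∀ᶠ x in 𝓝 (P z), HasFDerivAt f (ε • innerSL ℝ (g x)) x)
    (hg : HasFDerivAt g g' (P z)) (hgz : g (P z) = ν • P z)
    (hmin : IsStrongLocalMinOn f (Metric.sphere 0 1) (P z)) {U : Set V} (hU : U ∈ 𝓝 z) :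
    ∃ c > 0, ∃ C > 0, ∀ᶠ X in 𝓝 z, ‖P X‖ = 1 → ∀ Y, IsSolutionWhileIn v M U Y → Y 0 = X →
      (∀ t, 0 ≤ t → Y t ∈ U) ∧ (∀ t, 0 ≤ t → ‖Y t - z‖ ≤ C * Real.exp (-c * t)) ∧
      AntitoneOn (fun t => f (P (Y t))) (Ici 0) ∧
      ∀ t, 0 ≤ t → |f (P (Y t)) - f (P z)| ≤ C * Real.exp (-c * t) := by
  obtain ⟨c, hc, hgrad⟩ := exists_le_inner_tangential_gradient hε hf hg hgz hmin
  obtain ⟨K, L, hL, hattr⟩ :=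
    exists_eventually_isSphericallyAttracted hc hv hg.continuousAt hτ hP hgrad
  refine ⟨c / 2, half_pos hc, exists_eventually_exponential_decay hL (half_pos hc).le
    (hattr.mono fun _ h => h.1) hf (hattr.mono fun Y h hu => ?_) hU⟩
  exact mul_nonpos_of_nonneg_of_nonpos hε.le (h.2 hu)

end PerturbedGradientFlow

section Flow

variable {E : Type*} [NormedAddCommGroup E] [NormedSpace ℝ E]

open scoped Manifold in
theorem exists_hasDerivAt_of_hasCompactSupport [CompleteSpace E] {f : E → E}
    (hf : ContDiff ℝ 1 f) (hsupp : HasCompactSupport f) (x₀ : E) :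
    ∃ Y : ℝ → E, Y 0 = x₀ ∧ ∀ t, HasDerivAt Y (f (Y t)) t := by
  obtain ⟨K, hK⟩ := hf.lipschitzWith_of_hasCompactSupport hsupp one_ne_zero
  obtain ⟨B, hB⟩ := hsupp.exists_bound_of_continuous hf.continuous
  lift B to NNReal using (norm_nonneg _).trans (hB x₀)
  have hlocal : ∀ a, ∃ Y : ℝ → E, Y 0 = x₀ ∧
      IsMIntegralCurveOn (I := 𝓘(ℝ, E)) Y f (Ioo (-a) a) := by
    intro a
    have h0 : (0 : ℝ) ∈ Icc (-|a|) |a| := by simp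
    have hpicard : IsPicardLindelof (fun _ => f) (⟨0, h0⟩ : Icc (-|a|) |a|) x₀ (B * |a|.toNNReal)
        0 B K := IsPicardLindelof.of_time_independent (fun x _ => hB x) hK.lipschitzOnWith (by simp)
    obtain ⟨Y, hY0, hY⟩ := hpicard.exists_eq_forall_mem_Icc_hasDerivWithinAt₀
    have hsub : Ioo (-a) a ⊆ Icc (-|a|) |a| :=
      Ioo_subset_Icc_self.trans (Icc_subset_Icc (neg_le_neg (le_abs_self a)) (le_abs_self a))
    exact ⟨Y, hY0, fun t ht => ((hY t (hsub ht)).mono hsub).hasFDerivWithinAt.hasMFDerivWithinAt⟩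
  obtain ⟨Y, hY0, hY⟩ := (exists_isMIntegralCurve_iff_exists_isMIntegralCurveOn_Ioo
    (contMDiff_vectorSpace_iff_contDiff.2 hf) x₀).2 hlocal
  refine ⟨Y, hY0, fun t => ?_⟩
  have hYt : HasFDerivAt Y (ContinuousLinearMap.toSpanSingleton ℝ (f (Y t))) t :=
    (hY t).hasFDerivAt
  simpa using hYt.hasDerivAt

theorem norm_slope_infDist_lt {S : Set E} {Y γ : ℝ → E} {y' γ' : E} {t r : ℝ}
    (hY : HasDerivWithinAt Y y' (Ici t) t) (hγ : HasDerivWithinAt γ γ' (Ici 0) 0)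
    (hγS : ∀ s, γ s ∈ S) (hdist : Metric.infDist (Y t) S = ‖Y t - γ 0‖) (hr : ‖y' - γ'‖ < r) :
    ∃ᶠ s in 𝓝[>] t, (s - t)⁻¹ * (Metric.infDist (Y s) S - Metric.infDist (Y t) S) < r := by
  have hγt : HasDerivWithinAt (fun s => γ (s - t)) γ' (Ici t) t := by
    have h := HasDerivWithinAt.scomp t (h := fun s => s - t) (t' := Ici 0)
      (by simpa only [sub_self] using hγ) ((hasDerivWithinAt_id t (Ici t)).sub_const t)
      (fun s hs => sub_nonneg.2 hs)
    simpa only [Function.comp_def, one_smul] using h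
  refine ((hY.sub hγt).liminf_right_slope_norm_le hr).mp ?_
  filter_upwards [self_mem_nhdsWithin] with s hs hlt
  refine lt_of_le_of_lt ?_ hlt
  have hst : 0 ≤ (s - t)⁻¹ := inv_nonneg.2 (sub_nonneg.2 (mem_Ioi.1 hs).le)
  have hle : Metric.infDist (Y s) S ≤ ‖Y s - γ (s - t)‖ :=
    (Metric.infDist_le_dist_of_mem (hγS _)).trans_eq (dist_eq_norm _ _)
  simp only [Pi.sub_apply, sub_self, hdist]
  gcongr

/-- Nagumo's invariance theorem, with tangency to `S` expressed by curves in `S`: the distance to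
`S` satisfies a Grönwall inequality, seen by comparison with the curve through a nearest point. -/
theorem mem_of_hasDerivWithinAt_of_tangent [ProperSpace E] {S : Set E} (hS : IsClosed S)
    {f : E → E} {K : NNReal} (hf : LipschitzWith K f)
    (htangent : ∀ x ∈ S, ∃ γ : ℝ → E, (∀ s, γ s ∈ S) ∧ γ 0 = x ∧
      HasDerivWithinAt γ (f x) (Ici 0) 0)
    {Y : ℝ → E} (hY : ∀ t, 0 ≤ t → HasDerivWithinAt Y (f (Y t)) (Ici 0) t) (h0 : Y 0 ∈ S) :
    ∀ t, 0 ≤ t → Y t ∈ S := by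
  intro T hT
  have hcont : ContinuousOn Y (Ici 0) := fun t ht => (hY t ht).continuousWithinAt
  suffices h : Metric.infDist (Y T) S ≤ 0 from
    (hS.mem_iff_infDist_zero ⟨_, h0⟩).2 (le_antisymm h Metric.infDist_nonneg)
  have hgronwall := le_gronwallBound_of_liminf_deriv_right_le
    (f := fun t => Metric.infDist (Y t) S) (f' := fun t => K * Metric.infDist (Y t) S) (δ := 0)
    (K := K) (ε := 0) (a := 0) (b := T)
    ((Metric.continuous_infDist_pt S).comp_continuousOn (hcont.mono Icc_subset_Ici_self)) ?_
    (Metric.infDist_zero_of_mem h0).le (fun t _ => by simp) T (right_mem_Icc.2 hT)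
  · simpa only [gronwallBound_ε0_δ0] using hgronwall
  intro t ht r hr
  obtain ⟨x, hx, hdist⟩ := hS.exists_infDist_eq_dist ⟨_, h0⟩ (Y t)
  obtain ⟨γ, hγS, rfl, hγ⟩ := htangent x hx
  rw [dist_eq_norm] at hdist
  refine norm_slope_infDist_lt ((hY t ht.1).mono (Ici_subset_Ici.2 ht.1)) hγ hγS hdist ?_
  refine lt_of_le_of_lt ?_ hr
  simpa only [hdist, dist_eq_norm] using hf.dist_le_mul (Y t) (γ 0)

theorem exists_contDiff_hasCompactSupport_eventuallyEq [FiniteDimensional ℝ E] {F : Type*}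
    [NormedAddCommGroup F] [NormedSpace ℝ F] {f : E → F} {x : E} (hf : ContDiffAt ℝ 1 f x) :
    ∃ g : E → F, ContDiff ℝ 1 g ∧ HasCompactSupport g ∧ g =ᶠ[𝓝 x] f := by
  obtain ⟨R, hR, hball⟩ := Metric.eventually_nhds_iff_ball.1 (hf.eventually (by simp))
  let χ : ContDiffBump x := ⟨R / 4, R / 2, by positivity, by linarith⟩
  refine ⟨fun y => χ y • f y, contDiff_iff_contDiffAt.2 fun y => ?_,
    χ.hasCompactSupport.smul_right, ?_⟩
  · by_cases hy : y ∈ tsupport χ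
    · have hyR : dist y x ≤ R / 2 := χ.tsupport_eq.le hy
      exact χ.contDiffAt.smul (hball y (hyR.trans_lt (half_lt_self hR)))
    · refine (contDiffAt_const (c := (0 : F))).congr_of_eventuallyEq ?_
      filter_upwards [notMem_tsupport_iff_eventuallyEq.1 hy] with w hw
      simp [hw]
  · filter_upwards [χ.eventuallyEq_one] with y hy
    simp [hy]

end Flow

/-- Real square matrices of size `n`. -/
abbrev SqMat (n : ℕ) := Matrix (Fin n) (Fin n) ℝ

section MatrixCalculus

variable {n : ℕ} {E : Type*} [NormedAddCommGroup E] [NormedSpace ℝ E]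

theorem contDiffAt_matrix_mul {f g : E → SqMat n} {x : E} {m : WithTop ℕ∞}
    (hf : ContDiffAt ℝ m f x) (hg : ContDiffAt ℝ m g x) :
    ContDiffAt ℝ m (fun y => f y * g y) x := by
  let _ : NormedRing (SqMat n) := Matrix.frobeniusNormedRing
  let _ : NormedAlgebra ℝ (SqMat n) := Matrix.frobeniusNormedAlgebra
  exact ContDiffAt.mul (𝔸 := SqMat n) hf hg

theorem hasDerivAt_matrix_mul {f g : ℝ → SqMat n} {f' g' : SqMat n} {t : ℝ}
    (hf : HasDerivAt f f' t) (hg : HasDerivAt g g' t) :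
    HasDerivAt (fun s => f s * g s) (f' * g t + f t * g') t := by
  let _ : NormedRing (SqMat n) := Matrix.frobeniusNormedRing
  let _ : NormedAlgebra ℝ (SqMat n) := Matrix.frobeniusNormedAlgebra
  exact HasDerivAt.mul (𝔸 := SqMat n) hf hg

theorem contDiffAt_matrix_transpose {f : E → SqMat n} {x : E} {m : WithTop ℕ∞}
    (hf : ContDiffAt ℝ m f x) : ContDiffAt ℝ m (fun y => (f y).transpose) x :=
  (LinearMap.toContinuousLinearMap
    (Matrix.transposeLinearEquiv (Fin n) (Fin n) ℝ ℝ).toLinearMap).contDiff.contDiffAt.comp x hf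

theorem contDiffAt_matrix_inv {A : SqMat n} {m : WithTop ℕ∞} (hA : IsUnit A) :
    ContDiffAt ℝ m (fun B : SqMat n => B⁻¹) A := by
  let _ : NormedRing (SqMat n) := Matrix.frobeniusNormedRing
  let _ : NormedAlgebra ℝ (SqMat n) := Matrix.frobeniusNormedAlgebra
  have hinv : (fun B : SqMat n => B⁻¹) = Ring.inverse := funext Matrix.nonsing_inv_eq_ringInverse
  rw [hinv]
  obtain ⟨u, rfl⟩ := hA
  exact contDiffAt_ringInverse ℝ u

theorem eventually_isUnit_matrix {A : SqMat n} (hA : IsUnit A) : ∀ᶠ B in 𝓝 A, IsUnit B := by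
  let _ : NormedRing (SqMat n) := Matrix.frobeniusNormedRing
  exact Units.isOpen.mem_nhds hA

theorem isUnit_of_mulVec_eq_zero_imp {A : SqMat n} (h : ∀ v, A.mulVec v = 0 → v = 0) :
    IsUnit A :=
  Matrix.mulVec_injective_iff_isUnit.1
    ((injective_iff_map_eq_zero A.mulVecLin.toAddMonoidHom).2 fun v hv => h v hv)

end MatrixCalculus

section Rank

variable {n : ℕ}

theorem matrix_rank_add_le (A B : SqMat n) : (A + B).rank ≤ A.rank + B.rank := by
  have hrange : LinearMap.range (A + B).mulVecLin ≤
      LinearMap.range A.mulVecLin ⊔ LinearMap.range B.mulVecLin := by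
    rw [Matrix.mulVecLin_add]
    exact LinearMap.range_add_le _ _
  exact (Submodule.finrank_mono hrange).trans (Submodule.finrank_add_le_finrank_add_finrank _ _)

theorem isClosed_rank_le (r : ℕ) : IsClosed {A : SqMat n | A.rank ≤ r} := by
  have hopen := (isOpen_setOfPred_nat_le_rank (𝕜 := ℝ) (E := Fin n → ℝ) (F := Fin n → ℝ)
    (r + 1)).isClosed_compl
  have hcont : Continuous fun A : SqMat n => LinearMap.toContinuousLinearMap (Matrix.toLin' A) :=
    LinearMap.continuous_of_finiteDimensional
      ((LinearMap.toContinuousLinearMap :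
        ((Fin n → ℝ) →ₗ[ℝ] (Fin n → ℝ)) ≃ₗ[ℝ] _).toLinearMap ∘ₗ (Matrix.toLin').toLinearMap)
  convert hopen.preimage hcont using 1
  ext A
  simp only [mem_preimage, mem_compl_iff, mem_ofPred_eq, not_le,
    LinearMap.coe_toContinuousLinearMap]
  rw [LinearMap.rank, ← Module.finrank_eq_rank, Nat.cast_lt, Nat.lt_succ_iff]
  rfl

theorem eventually_le_rank (Z : SqMat n) : ∀ᶠ Y in 𝓝 Z, Z.rank ≤ Y.rank := by
  rcases Nat.eq_zero_or_pos Z.rank with h0 | hpos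
  · simp [h0]
  filter_upwards [(isClosed_rank_le (Z.rank - 1)).isOpen_compl.mem_nhds
    (show ¬ Z.rank ≤ Z.rank - 1 by omega)] with Y hY
  have hY' : ¬ Y.rank ≤ Z.rank - 1 := hY
  omega

theorem isClosed_isSymm : IsClosed {A : SqMat n | A.IsSymm} :=
  isClosed_eq (continuous_id.matrix_transpose) continuous_id

/-- The curves `s ↦ (1 + s C) Y (1 + s C)ᵀ` of symmetric matrices of rank at most `rank Y` have the
field as their initial velocity. -/
theorem exists_flow_isSymm_rank_le {C : SqMat n → SqMat n} (hC : ContDiff ℝ 1 C)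
    (hsupp : HasCompactSupport C) {r : ℕ} {Y₀ : SqMat n} (hs : Y₀.IsSymm) (hr : Y₀.rank ≤ r) :
    ∃ Y : ℝ → SqMat n, Y 0 = Y₀ ∧ ∀ t, 0 ≤ t → (Y t).IsSymm ∧ (Y t).rank ≤ r ∧
      HasDerivWithinAt Y (C (Y t) * Y t + Y t * (C (Y t)).transpose) (Ici 0) t := by
  set f : SqMat n → SqMat n := fun Y => C Y * Y + Y * (C Y).transpose with hf
  have hfC : ContDiff ℝ 1 f := contDiff_iff_contDiffAt.2 fun Y =>
    (contDiffAt_matrix_mul hC.contDiffAt contDiffAt_id).add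
      (contDiffAt_matrix_mul contDiffAt_id (contDiffAt_matrix_transpose hC.contDiffAt))
  have hfsupp : HasCompactSupport f := hsupp.mono fun Y hY hCY => hY (by simp [hf, hCY])
  obtain ⟨K, hK⟩ := hfC.lipschitzWith_of_hasCompactSupport hfsupp one_ne_zero
  obtain ⟨Y, hY0, hY⟩ := exists_hasDerivAt_of_hasCompactSupport hfC hfsupp Y₀
  have hmem := mem_of_hasDerivWithinAt_of_tangent (S := {A | A.IsSymm} ∩ {A | A.rank ≤ r})
    (isClosed_isSymm.inter (isClosed_rank_le r)) hK (fun A hA => ?_)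
    (fun t _ => (hY t).hasDerivWithinAt) (by rw [hY0]; exact ⟨hs, hr⟩)
  · exact ⟨Y, hY0, fun t ht => ⟨(hmem t ht).1, (hmem t ht).2, (hY t).hasDerivWithinAt⟩⟩
  refine ⟨fun s => (1 + s • C A) * A * (1 + s • (C A).transpose), fun s => ⟨?_, ?_⟩, by simp, ?_⟩
  · simp [Matrix.IsSymm, Matrix.transpose_mul, Matrix.mul_assoc, hA.1.eq]
  · exact (Matrix.rank_mul_le_left _ _).trans ((Matrix.rank_mul_le_right _ _).trans hA.2)
  · have hline : ∀ D : SqMat n, HasDerivAt (fun s : ℝ => 1 + s • D) D 0 := fun D =>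
      (((hasDerivAt_id (0 : ℝ)).smul_const D).const_add 1).congr_deriv (one_smul ℝ D)
    have hcurve := hasDerivAt_matrix_mul
      (hasDerivAt_matrix_mul (hline (C A)) (hasDerivAt_const 0 A)) (hline (C A).transpose)
    simpa [hf] using hcurve.hasDerivWithinAt (s := Ici 0)

theorem exists_isSolutionWhileIn_of_eq_mul_add_mul_transpose {v C : SqMat n → SqMat n}
    {Z : SqMat n} (hC : ContDiffAt ℝ 1 C Z)
    (hv : ∀ᶠ Y in 𝓝 Z, Y.IsSymm → Y.rank = Z.rank → v Y = C Y * Y + Y * (C Y).transpose) :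
    ∃ U ∈ 𝓝 Z, ∀ Y₀ : SqMat n, Y₀.IsSymm → Y₀.rank = Z.rank → ∃ Y : ℝ → SqMat n, Y 0 = Y₀ ∧
      IsSolutionWhileIn v {A | A.rank = Z.rank ∧ A.IsSymm} U Y := by
  obtain ⟨C', hC', hsupp, heq⟩ := exists_contDiff_hasCompactSupport_eventuallyEq hC
  refine ⟨_, (eventually_le_rank Z).and (heq.and hv), fun Y₀ hs hr => ?_⟩
  obtain ⟨Y, hY0, hY⟩ := exists_flow_isSymm_rank_le hC' hsupp hs hr.le
  refine ⟨Y, hY0, fun t ht => (hY t ht).2.2.continuousWithinAt, fun t ht hU => ?_⟩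
  obtain ⟨hrank, hCC', hvC⟩ := hU
  obtain ⟨hsymm, hle, hderiv⟩ := hY t ht
  refine ⟨⟨le_antisymm hle hrank, hsymm⟩, ?_⟩
  rwa [hvC hsymm (le_antisymm hle hrank), ← hCC']

end Rank

section RangeProj

variable {n : ℕ}

theorem eq_rangeProj {Y P X : SqMat n} (hs : P.IsSymm) (hPY : P * Y = Y) (hP : P = Y * X) :
    P = rangeProj Y := by
  obtain ⟨X', hX'⟩ := exists_rangeProj_eq_mul Y
  have hleft : rangeProj Y * P = P := by rw [hP, ← Matrix.mul_assoc, rangeProj_mul_self]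
  have hright : P * rangeProj Y = rangeProj Y := by rw [hX', ← Matrix.mul_assoc, hPY]
  have := congrArg Matrix.transpose hleft
  rw [Matrix.transpose_mul, rangeProj_transpose, hs.eq, hright] at this
  exact this.symm

theorem rangeProj_mul_rangeProj (Y : SqMat n) : rangeProj Y * rangeProj Y = rangeProj Y := by
  obtain ⟨X, hX⟩ := exists_rangeProj_eq_mul Y
  conv_lhs => rw [hX, ← Matrix.mul_assoc, ← hX, rangeProj_mul_self]
  exact hX.symm

theorem mul_rangeProj_transpose (Y : SqMat n) : Y * rangeProj Y.transpose = Y := by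
  have := congrArg Matrix.transpose (rangeProj_mul_self Y.transpose)
  rwa [Matrix.transpose_mul, rangeProj_transpose, Matrix.transpose_transpose] at this

theorem rangeProj_smul {c : ℝ} (hc : c ≠ 0) (Y : SqMat n) : rangeProj (c • Y) = rangeProj Y := by
  obtain ⟨X, hX⟩ := exists_rangeProj_eq_mul Y
  refine (eq_rangeProj (X := c⁻¹ • X) (rangeProj_transpose Y) ?_ ?_).symm
  · rw [Matrix.mul_smul, rangeProj_mul_self]
  · rw [Matrix.smul_mul, Matrix.mul_smul, smul_inv_smul₀ hc, hX]

theorem rangeProj_mul_of_rank_le {Y P : SqMat n} (h : Y.rank ≤ (Y * P).rank) :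
    rangeProj (Y * P) = rangeProj Y := by
  have hrange : LinearMap.range (Matrix.toEuclideanLin (Y * P)) =
      LinearMap.range (Matrix.toEuclideanLin Y) := by
    refine Submodule.eq_of_le_of_finrank_le ?_ ?_
    · rintro _ ⟨v, rfl⟩
      exact ⟨Matrix.toEuclideanLin P v, by simp [Matrix.toLpLin_apply, Matrix.mulVec_mulVec]⟩
    · rwa [Matrix.toEuclideanLin_eq_toLin_orthonormal, ← Matrix.rank_eq_finrank_range_toLin,
        ← Matrix.rank_eq_finrank_range_toLin]
  simp only [rangeProj, hrange]

theorem isUnit_transpose_mul_self_add_one_sub_rangeProj (A : SqMat n) :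
    IsUnit (A.transpose * A + (1 - rangeProj A.transpose)) := by
  refine isUnit_of_mulVec_eq_zero_imp fun v hv => ?_
  obtain ⟨X, hX⟩ := exists_rangeProj_eq_mul A.transpose
  have hgram : (A.transpose * A).mulVec v = 0 := by
    have := congrArg (rangeProj A.transpose).mulVec hv
    rwa [Matrix.mulVec_mulVec, Matrix.mulVec_zero, mul_add, ← Matrix.mul_assoc,
      rangeProj_mul_self, mul_sub, rangeProj_mul_rangeProj, mul_one, sub_self, add_zero] at this
  have hAv : A.mulVec v = 0 := by
    simpa [Matrix.conjTranspose_eq_transpose_of_trivial] using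
      (Matrix.conjTranspose_mul_self_mulVec_eq_zero A v).1 (by simpa using hgram)
  have hPv : (rangeProj A.transpose).mulVec v = 0 := by
    rw [← rangeProj_transpose, hX, Matrix.transpose_mul, Matrix.transpose_transpose,
      ← Matrix.mulVec_mulVec, hAv, Matrix.mulVec_zero]
  rwa [Matrix.add_mulVec, hgram, zero_add, Matrix.sub_mulVec, Matrix.one_mulVec, hPv,
    sub_zero] at hv

theorem rank_le_of_isUnit_transpose_mul_self_add {A W P : SqMat n} (hAP : A * P = A)
    (hN : IsUnit (W.transpose * W + (1 - P))) : A.rank ≤ W.rank := by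
  have hfull : n ≤ (W.transpose * W).rank + (1 - P).rank := by
    simpa [Matrix.rank_of_isUnit _ hN] using matrix_rank_add_le (W.transpose * W) (1 - P)
  have hker : A.rank + (1 - P).rank ≤ n := by
    simpa using Matrix.rank_add_rank_le_card_of_mul_eq_zero (A := A) (B := 1 - P)
      (by rw [mul_sub, mul_one, hAP, sub_self])
  rw [Matrix.rank_transpose_mul_self] at hfull
  omega

theorem mul_inv_mul_transpose_eq_rangeProj {W P : SqMat n} (hs : P.IsSymm) (hPP : P * P = P)
    (hWP : W * P = W) (hN : IsUnit (W.transpose * W + (1 - P))) :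
    W * (W.transpose * W + (1 - P))⁻¹ * W.transpose = rangeProj W := by
  set N := W.transpose * W + (1 - P) with hNdef
  have hdet : IsUnit N.det := (Matrix.isUnit_iff_isUnit_det _).1 hN
  have hNs : N.IsSymm := by simp [hNdef, Matrix.IsSymm, hs.eq]
  have hW0 : W * (1 - P) = 0 := by rw [mul_sub, mul_one, hWP, sub_self]
  have hNP : N * (1 - P) = 1 - P := by
    rw [hNdef, add_mul, Matrix.mul_assoc, hW0, mul_zero, zero_add, mul_sub, mul_one, sub_mul,
      one_mul, hPP, sub_self, sub_zero]
  have hNinvP : N⁻¹ * (1 - P) = 1 - P := by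
    conv_lhs => rw [← hNP, Matrix.nonsing_inv_mul_cancel_left _ _ hdet]
  refine eq_rangeProj (X := N⁻¹ * W.transpose) ?_ ?_ (Matrix.mul_assoc _ _ _)
  · simp only [Matrix.IsSymm, Matrix.transpose_mul, Matrix.transpose_transpose,
      Matrix.transpose_nonsing_inv, hNs.eq, Matrix.mul_assoc]
  · have hgram : W.transpose * W = N - (1 - P) := by simp [hNdef]
    rw [Matrix.mul_assoc _ W.transpose, hgram, Matrix.mul_assoc, mul_sub N⁻¹,
      Matrix.nonsing_inv_mul _ hdet, hNinvP, sub_sub_cancel, hWP]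

/-- With `P` the projection onto the row space of `Y₀` and `W = Y P`, the normal equations give the
range projection of `Y` as `W (Wᵀ W + (1 - P))⁻¹ Wᵀ`. -/
theorem exists_contDiffAt_mul_eq_rangeProj (Y₀ : SqMat n) {m : WithTop ℕ∞} :
    ∃ X : SqMat n → SqMat n, ContDiffAt ℝ m X Y₀ ∧
      ∀ᶠ Y in 𝓝 Y₀, Y.rank ≤ Y₀.rank → Y * X Y = rangeProj Y := by
  set P := rangeProj Y₀.transpose
  have hPs : P.IsSymm := rangeProj_transpose _
  have hPP : P * P = P := rangeProj_mul_rangeProj _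
  have hYP : Y₀ * P = Y₀ := mul_rangeProj_transpose Y₀
  let N : SqMat n → SqMat n := fun Y => (Y * P).transpose * (Y * P) + (1 - P)
  have hYPsmooth : ContDiffAt ℝ m (fun Y => Y * P) Y₀ :=
    contDiffAt_matrix_mul contDiffAt_id contDiffAt_const
  have hN : ContDiffAt ℝ m N Y₀ :=
    (contDiffAt_matrix_mul (contDiffAt_matrix_transpose hYPsmooth) hYPsmooth).add contDiffAt_const
  have hN₀ : IsUnit (N Y₀) := by
    simpa only [N, hYP] using isUnit_transpose_mul_self_add_one_sub_rangeProj Y₀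
  refine ⟨fun Y => P * (N Y)⁻¹ * (Y * P).transpose, ?_, ?_⟩
  · exact contDiffAt_matrix_mul (contDiffAt_matrix_mul contDiffAt_const
      ((contDiffAt_matrix_inv hN₀).comp Y₀ hN)) (contDiffAt_matrix_transpose hYPsmooth)
  filter_upwards [hN.continuousAt.eventually (eventually_isUnit_matrix hN₀)] with Y hU hrank
  have hWP : Y * P * P = Y * P := by rw [Matrix.mul_assoc, hPP]
  rw [← rangeProj_mul_of_rank_le
    (hrank.trans (rank_le_of_isUnit_transpose_mul_self_add hYP hU)),
    ← mul_inv_mul_transpose_eq_rangeProj hPs hPP hWP hU]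
  simp only [N, Matrix.mul_assoc]

theorem exists_lipschitzOnWith_rangeProj (Z : SqMat n) :
    ∃ K, ∃ U ∈ 𝓝 Z, LipschitzOnWith K rangeProj (U ∩ {Y | Y.rank ≤ Z.rank}) := by
  obtain ⟨X, hX, hYX⟩ := exists_contDiffAt_mul_eq_rangeProj (m := 1) Z
  obtain ⟨K, U, hU, hK⟩ := (contDiffAt_matrix_mul contDiffAt_id hX).exists_lipschitzOnWith
  refine ⟨K, _, inter_mem hU hYX, fun A hA B hB => ?_⟩
  rw [← hA.1.2 hA.2, ← hB.1.2 hB.2]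
  exact hK hA.1.1 hB.1.1

end RangeProj

section TangentProj

variable {n : ℕ}

theorem tangentProj_smul (Y A : SqMat n) (c : ℝ) :
    tangentProj Y (c • A) = c • tangentProj Y A := by
  simp only [tangentProj, smul_sub, Matrix.mul_smul, Matrix.smul_mul]

theorem sub_tangentProj_eq_mul_mul (Y A : SqMat n) : A - tangentProj Y A =
    (rangeProj A - rangeProj Y) * A * (rangeProj A.transpose - rangeProj Y.transpose) := by
  have hleft : (rangeProj A - rangeProj Y) * A = (1 - rangeProj Y) * A := by
    rw [sub_mul, sub_mul, rangeProj_mul_self, one_mul]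
  have hright : A * (rangeProj A.transpose - rangeProj Y.transpose) =
      A * (1 - rangeProj Y.transpose) := by
    rw [mul_sub, mul_sub, mul_rangeProj_transpose, mul_one]
  rw [hleft, Matrix.mul_assoc, hright, tangentProj, sub_sub_cancel, Matrix.mul_assoc]

/-- Both outer factors in `sub_tangentProj_eq_mul_mul` vanish to first order as `A - Y → 0`. -/
theorem sub_tangentProj_isBigO (Z : SqMat n) :
    (fun p : SqMat n × SqMat n => p.2 - tangentProj p.1 p.2)
      =O[𝓝[{Y | Y.rank ≤ Z.rank} ×ˢ {A | A.rank ≤ Z.rank}] (Z, Z)] fun p => ‖p.2 - p.1‖ ^ 2 := by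
  obtain ⟨K, U, hU, hK⟩ := exists_lipschitzOnWith_rangeProj Z
  obtain ⟨K', U', hU', hK'⟩ := exists_lipschitzOnWith_rangeProj Z.transpose
  have htranspose : ∀ᶠ Y in 𝓝 Z, Y.transpose ∈ U' :=
    (continuous_id.matrix_transpose.tendsto Z).eventually hU'
  have hbound : ∀ᶠ A in 𝓝 Z, ‖A‖ < ‖Z‖ + 1 :=
    continuous_norm.continuousAt.eventually_lt_const (lt_add_one _)
  refine Asymptotics.IsBigO.of_bound (K * (‖Z‖ + 1) * K') ?_
  filter_upwards [self_mem_nhdsWithin, mem_nhdsWithin_of_mem_nhds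
    (prod_mem_nhds (inter_mem hU htranspose) (inter_mem (inter_mem hU htranspose) hbound))]
    with ⟨Y, A⟩ ⟨hY, hA⟩ ⟨⟨hYU, hYU'⟩, ⟨hAU, hAU'⟩, hAZ⟩
  have hrange := hK.norm_sub_le ⟨hAU, hA⟩ ⟨hYU, hY⟩
  have hrow := hK'.norm_sub_le (x := A.transpose) (y := Y.transpose)
    ⟨hAU', by simpa [Matrix.rank_transpose] using hA⟩
    ⟨hYU', by simpa [Matrix.rank_transpose] using hY⟩
  rw [← Matrix.transpose_sub, Matrix.frobenius_norm_transpose] at hrow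
  rw [sub_tangentProj_eq_mul_mul, Real.norm_of_nonneg (sq_nonneg _)]
  calc _ ≤ ‖rangeProj A - rangeProj Y‖ * ‖A‖ *
        ‖rangeProj A.transpose - rangeProj Y.transpose‖ :=
        (Matrix.frobenius_norm_mul _ _).trans
          (mul_le_mul_of_nonneg_right (Matrix.frobenius_norm_mul _ _) (norm_nonneg _))
    _ ≤ K * ‖A - Y‖ * (‖Z‖ + 1) * (K' * ‖A - Y‖) := by gcongr; exact hAZ.le
    _ = K * (‖Z‖ + 1) * K' * ‖A - Y‖ ^ 2 := by ring

theorem tangentProj_eq_mul_add_mul_transpose {Y A X : SqMat n} (hY : Y.IsSymm) (hA : A.IsSymm)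
    (hX : Y * X = rangeProj Y) :
    tangentProj Y A = (1 - (2⁻¹ : ℝ) • rangeProj Y) * A * X.transpose * Y +
      Y * ((1 - (2⁻¹ : ℝ) • rangeProj Y) * A * X.transpose).transpose := by
  have hXY : X.transpose * Y = rangeProj Y := by
    rw [← rangeProj_transpose, ← hX, Matrix.transpose_mul, hY.eq]
  have htranspose : ((1 - (2⁻¹ : ℝ) • rangeProj Y) * A * X.transpose).transpose =
      X * (A * (1 - (2⁻¹ : ℝ) • rangeProj Y)) := by
    simp [Matrix.transpose_mul, rangeProj_transpose, hA.eq]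
  rw [htranspose, Matrix.mul_assoc _ X.transpose, hXY, ← Matrix.mul_assoc Y, hX, tangentProj,
    hY.eq]
  simp only [sub_mul, mul_sub, one_mul, mul_one, Matrix.smul_mul, Matrix.mul_smul,
    Matrix.mul_assoc]
  module

end TangentProj

section FrobeniusInner

variable {n : ℕ}

theorem frobInner_eq_sum (A B : SqMat n) : frobInner A B = ∑ i, ∑ j, A i j * B i j := by
  rw [frobInner, Matrix.trace, Finset.sum_comm]
  simp [Matrix.mul_apply]

theorem frobInner_self (A : SqMat n) : frobInner A A = ‖A‖ ^ 2 := by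
  rw [frobInner_eq_sum, Matrix.frobenius_norm_def, ← Real.sqrt_eq_rpow,
    Real.sq_sqrt (by positivity)]
  simp [sq]

theorem frobInner_vecMulVec (u v : Fin n → ℝ) (A : SqMat n) :
    frobInner (Matrix.vecMulVec u v) A = u ⬝ᵥ A.mulVec v := by
  rw [frobInner_eq_sum]
  simp only [Matrix.vecMulVec_apply, dotProduct, Matrix.mulVec, Finset.mul_sum]
  exact Finset.sum_congr rfl fun i _ => Finset.sum_congr rfl fun j _ => by ring

/-- The inner product space structure given by `frobInner`; its norm is the Frobenius norm. -/
@[reducible]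
noncomputable def frobeniusInnerProductSpace (n : ℕ) : InnerProductSpace ℝ (SqMat n) :=
  { Matrix.frobeniusNormedSpace with
    inner := frobInner
    norm_sq_eq_re_inner := fun A => (frobInner_self A).symm
    conj_inner_symm := fun A B => by simp only [frobInner_eq_sum, mul_comm, conj_trivial]
    add_left := fun A B C => by simp [frobInner_eq_sum, add_mul, Finset.sum_add_distrib]
    smul_left := fun A B r => by simp [frobInner_eq_sum, mul_assoc, Finset.mul_sum] }

end FrobeniusInner

section Weyl

variable {E : Type*} [NormedAddCommGroup E] [InnerProductSpace ℝ E] [FiniteDimensional ℝ E]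
  {T T' : E →ₗ[ℝ] E} {N : ℕ} {i : Fin N} {v : E}

theorem inner_apply_self_eq_sum (hT : T.IsSymmetric) (hN : Module.finrank ℝ E = N) (v : E) :
    inner ℝ (T v) v = ∑ k, hT.eigenvalues hN k * inner ℝ (hT.eigenvectorBasis hN k) v ^ 2 := by
  rw [← (hT.eigenvectorBasis hN).sum_inner_mul_inner (T v) v]
  refine Finset.sum_congr rfl fun k _ => ?_
  rw [hT v, hT.apply_eigenvectorBasis, inner_smul_right, real_inner_comm]
  simp only [RCLike.ofReal_real_eq_id, id]
  ring

theorem eigenvalues_mul_norm_sq_le_inner (hT : T.IsSymmetric) (hN : Module.finrank ℝ E = N)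
    (hv : ∀ k, i < k → inner ℝ (hT.eigenvectorBasis hN k) v = 0) :
    hT.eigenvalues hN i * ‖v‖ ^ 2 ≤ inner ℝ (T v) v := by
  rw [inner_apply_self_eq_sum hT hN, ← (hT.eigenvectorBasis hN).sum_sq_inner_right v,
    Finset.mul_sum]
  refine Finset.sum_le_sum fun k _ => ?_
  rcases le_or_gt k i with hk | hk
  · exact mul_le_mul_of_nonneg_right (hT.eigenvalues_antitone hN hk) (sq_nonneg _)
  · simp [hv k hk]

theorem inner_le_eigenvalues_mul_norm_sq (hT : T.IsSymmetric) (hN : Module.finrank ℝ E = N)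
    (hv : ∀ k, k < i → inner ℝ (hT.eigenvectorBasis hN k) v = 0) :
    inner ℝ (T v) v ≤ hT.eigenvalues hN i * ‖v‖ ^ 2 := by
  rw [inner_apply_self_eq_sum hT hN, ← (hT.eigenvectorBasis hN).sum_sq_inner_right v,
    Finset.mul_sum]
  refine Finset.sum_le_sum fun k _ => ?_
  rcases le_or_gt i k with hk | hk
  · exact mul_le_mul_of_nonneg_right (hT.eigenvalues_antitone hN hk) (sq_nonneg _)
  · simp [hv k hk]

theorem exists_ne_zero_inner_eq_zero (hN : Module.finrank ℝ E = N) (i : Fin N) (b b' : Fin N → E) :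
    ∃ v ≠ 0, (∀ k, i < k → inner ℝ (b k) v = 0) ∧ ∀ k, k < i → inner ℝ (b' k) v = 0 := by
  let φ : E →ₗ[ℝ] ({k : Fin N // k ≠ i} → ℝ) := LinearMap.pi fun k =>
    (innerSL ℝ (if i < k.1 then b k.1 else b' k.1)).toLinearMap
  have hker : LinearMap.ker φ ≠ ⊥ := by
    apply LinearMap.ker_ne_bot_of_finrank_lt
    rw [hN, Module.finrank_fintype_fun_eq_card, Fintype.card_subtype_compl, Fintype.card_fin,
      Fintype.card_subtype_eq]
    exact Nat.sub_lt i.pos one_pos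
  obtain ⟨v, hv, hv0⟩ := Submodule.exists_mem_ne_zero_of_ne_bot hker
  have hφ (k) (hk : k ≠ i) : inner ℝ (if i < k then b k else b' k) v = 0 :=
    congrFun (LinearMap.mem_ker.1 hv) ⟨k, hk⟩
  refine ⟨v, hv0, fun k hk => ?_, fun k hk => ?_⟩
  · simpa only [if_pos hk] using hφ k hk.ne'
  · simpa only [if_neg hk.not_gt] using hφ k hk.ne

/-- Weyl's inequality, by the Courant–Fischer dimension count. -/
theorem eigenvalues_le_add_of_inner_le (hT : T.IsSymmetric) (hT' : T'.IsSymmetric)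
    (hN : Module.finrank ℝ E = N) {c : ℝ}
    (h : ∀ v, inner ℝ (T v) v ≤ inner ℝ (T' v) v + c * ‖v‖ ^ 2) (i : Fin N) :
    hT.eigenvalues hN i ≤ hT'.eigenvalues hN i + c := by
  obtain ⟨v, hv0, hv, hv'⟩ := exists_ne_zero_inner_eq_zero hN i (hT.eigenvectorBasis hN)
    (hT'.eigenvectorBasis hN)
  refine le_of_mul_le_mul_right ?_ (pow_pos (norm_pos_iff.2 hv0) 2)
  calc hT.eigenvalues hN i * ‖v‖ ^ 2
      ≤ inner ℝ (T v) v := eigenvalues_mul_norm_sq_le_inner hT hN hv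
    _ ≤ inner ℝ (T' v) v + c * ‖v‖ ^ 2 := h v
    _ ≤ hT'.eigenvalues hN i * ‖v‖ ^ 2 + c * ‖v‖ ^ 2 := by
        gcongr
        exact inner_le_eigenvalues_mul_norm_sq hT' hN hv'
    _ = _ := (add_mul _ _ _).symm

variable {n : ℕ}

theorem norm_toEuclideanLin_le (A : SqMat n) (v : EuclideanSpace ℝ (Fin n)) :
    ‖Matrix.toEuclideanLin A v‖ ≤ ‖A‖ * ‖v‖ := by
  have hcol (u : Fin n → ℝ) : ‖Matrix.replicateCol (Fin 1) u‖ = ‖WithLp.toLp 2 u‖ :=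
    Matrix.frobenius_norm_replicateCol u
  have hmul := Matrix.frobenius_norm_mul A (Matrix.replicateCol (Fin 1) v.ofLp)
  rw [← Matrix.replicateCol_mulVec, hcol, hcol] at hmul
  simpa [Matrix.toLpLin_apply] using hmul

theorem eigval_le_add_norm_sub {A B : SqMat n} (hA : A.IsSymm) (hB : B.IsSymm) (j : ℕ) :
    eigval A j ≤ eigval B j + ‖A - B‖ := by
  by_cases hj : 1 ≤ j ∧ j ≤ n
  · rw [eigval, eigval, dif_pos ⟨Matrix.isHermitian_iff_isSymm.2 hA, hj⟩,
      dif_pos ⟨Matrix.isHermitian_iff_isSymm.2 hB, hj⟩]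
    refine eigenvalues_le_add_of_inner_le _ _ _ (fun v => ?_) _
    calc inner ℝ (Matrix.toEuclideanLin A v) v
        = inner ℝ (Matrix.toEuclideanLin B v) v +
          inner ℝ (Matrix.toEuclideanLin (A - B) v) v := by
          rw [← inner_add_left, map_sub, LinearMap.sub_apply, add_sub_cancel]
      _ ≤ inner ℝ (Matrix.toEuclideanLin B v) v + ‖A - B‖ * ‖v‖ * ‖v‖ := by
          gcongr
          exact (real_inner_le_norm _ _).trans (by gcongr; exact norm_toEuclideanLin_le _ _)
      _ = inner ℝ (Matrix.toEuclideanLin B v) v + ‖A - B‖ * ‖v‖ ^ 2 := by ring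
  · have hzero (C : SqMat n) : eigval C j = 0 := dif_neg fun h => hj h.2
    rw [hzero, hzero, zero_add]
    exact norm_nonneg _

theorem continuousAt_eigval {X : Type*} [TopologicalSpace X] {M : X → SqMat n}
    (hMs : ∀ p, (M p).IsSymm) {p : X} (hM : ContinuousAt M p) (j : ℕ) :
    ContinuousAt (fun q => eigval (M q) j) p := by
  refine tendsto_iff_dist_tendsto_zero.2 (squeeze_zero (fun _ => dist_nonneg) (fun q => ?_)
    (tendsto_iff_dist_tendsto_zero.1 hM))
  have hqp := eigval_le_add_norm_sub (hMs q) (hMs p) j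
  have hpq := eigval_le_add_norm_sub (hMs p) (hMs q) j
  rw [Real.dist_eq, dist_eq_norm, abs_sub_le_iff]
  rw [norm_sub_rev] at hpq
  constructor <;> linarith

end Weyl

section SimpleEigenvalue

open Matrix

attribute [local instance] frobeniusInnerProductSpace

variable {n : ℕ}

theorem eigvec_spec {A : SqMat n} (hA : A.IsSymm) {j : ℕ} (h1 : 1 ≤ j) (hn : j ≤ n) :
    eigvec A j ⬝ᵥ eigvec A j = 1 ∧ A *ᵥ eigvec A j = eigval A j • eigvec A j := by
  have h := exists_unit_eigenvector (isHermitian_iff_isSymm.2 hA) h1 hn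
  rw [eigvec, dif_pos h]
  exact h.choose_spec

/-- The spectral projection onto the line of the chosen eigenvector. -/
noncomputable def eigproj (A : SqMat n) (j : ℕ) : SqMat n := vecMulVec (eigvec A j) (eigvec A j)

theorem IsSimpleEigval.exists_eq_smul {A : SqMat n} {j : ℕ} (h : IsSimpleEigval A j)
    {v : Fin n → ℝ} (hv0 : v ≠ 0) (hv : A *ᵥ v = eigval A j • v) {u : Fin n → ℝ}
    (hu : A *ᵥ u = eigval A j • u) : ∃ a : ℝ, u = a • v := by
  have hmem {w} (hw : A *ᵥ w = eigval A j • w) :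
      w ∈ Module.End.eigenspace (toLin' A) (eigval A j) :=
    Module.End.mem_eigenspace_iff.2 (by rw [toLin'_apply, hw])
  have hne : (⟨v, hmem hv⟩ : Module.End.eigenspace (toLin' A) (eigval A j)) ≠ 0 :=
    fun h0 => hv0 (congrArg Subtype.val h0)
  obtain ⟨a, ha⟩ := (finrank_eq_one_iff_of_nonzero' _ hne).1 h ⟨u, hmem hu⟩
  exact ⟨a, (congrArg Subtype.val ha).symm⟩

theorem isSimpleEigval_of_forall_exists_eq_smul {A : SqMat n} (hA : A.IsSymm) {j : ℕ}
    (h1 : 1 ≤ j) (hn : j ≤ n) {v : Fin n → ℝ}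
    (h : ∀ u, A *ᵥ u = eigval A j • u → ∃ a : ℝ, u = a • v) : IsSimpleEigval A j := by
  obtain ⟨hunit, heig⟩ := eigvec_spec hA h1 hn
  have hne : eigvec A j ≠ 0 := by
    intro h0
    simp [h0] at hunit
  obtain ⟨c, hc⟩ := h _ heig
  have hc0 : c ≠ 0 := by
    rintro rfl
    exact hne (by rw [hc, zero_smul])
  have hmem : eigvec A j ∈ Module.End.eigenspace (toLin' A) (eigval A j) :=
    Module.End.mem_eigenspace_iff.2 (by rw [toLin'_apply, heig])
  refine (finrank_eq_one_iff_of_nonzero' ⟨_, hmem⟩ fun h0 => hne (congrArg Subtype.val h0)).2 ?_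
  rintro ⟨u, hu⟩
  obtain ⟨a, ha⟩ := h u (by simpa only [toLin'_apply] using Module.End.mem_eigenspace_iff.1 hu)
  refine ⟨a * c⁻¹, Subtype.ext ?_⟩
  calc (a * c⁻¹) • eigvec A j = (a * c⁻¹) • c • v := by rw [← hc]
    _ = u := by rw [smul_smul, inv_mul_cancel_right₀ hc0, ha]

/-- The matrix `μ - A + v vᵀ`. If `μ` is a simple eigenvalue of a symmetric `A` with eigenvector
`v`, it is invertible, and for nearby `A` its inverse maps `v` into the eigenspace of `μ`; this
makes the smooth dependence of simple eigenvectors explicit. -/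
def bordered (v : Fin n → ℝ) (μ : ℝ) (A : SqMat n) : SqMat n := μ • 1 - A + vecMulVec v v

section Bordered

variable {v : Fin n → ℝ} {μ : ℝ} {A : SqMat n}

theorem bordered_mulVec (u : Fin n → ℝ) :
    bordered v μ A *ᵥ u = μ • u - A *ᵥ u + (v ⬝ᵥ u) • v := by
  simp [bordered, add_mulVec, sub_mulVec, smul_mulVec, vecMulVec_mulVec]

theorem transpose_bordered (hA : A.IsSymm) : (bordered v μ A)ᵀ = bordered v μ A := by
  simp [bordered, hA.eq, transpose_vecMulVec]

theorem isUnit_bordered_eigvec (hA : A.IsSymm) {j : ℕ} (h1 : 1 ≤ j) (hn : j ≤ n)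
    (hs : IsSimpleEigval A j) : IsUnit (bordered (eigvec A j) (eigval A j) A) := by
  obtain ⟨hunit, heig⟩ := eigvec_spec hA h1 hn
  set v := eigvec A j
  refine isUnit_of_mulVec_eq_zero_imp fun u hu => ?_
  rw [bordered_mulVec] at hu
  have hAu : v ⬝ᵥ A *ᵥ u = eigval A j * (v ⬝ᵥ u) := by
    rw [dotProduct_mulVec, ← mulVec_transpose, hA.eq, heig, smul_dotProduct, smul_eq_mul]
  have hvu : v ⬝ᵥ u = 0 := by
    simpa [dotProduct_add, dotProduct_sub, dotProduct_smul, hAu, hunit] using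
      congrArg (fun w => v ⬝ᵥ w) hu
  rw [hvu, zero_smul, add_zero, sub_eq_zero] at hu
  have hv0 : v ≠ 0 := by
    intro h0
    simp [h0] at hunit
  obtain ⟨a, rfl⟩ := hs.exists_eq_smul hv0 heig hu.symm
  rw [dotProduct_smul, hunit, smul_eq_mul, mul_one] at hvu
  rw [hvu, zero_smul]

theorem contDiffAt_inv_bordered {m : WithTop ℕ∞} (h : IsUnit (bordered v μ A)) :
    ContDiffAt ℝ m (fun p : ℝ × SqMat n => (bordered v p.1 p.2)⁻¹) (μ, A) :=
  (contDiffAt_matrix_inv h).comp (μ, A) (((contDiffAt_fst.smul contDiffAt_const).sub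
    contDiffAt_snd).add contDiffAt_const)

theorem eq_smul_inv_bordered_mulVec (h : IsUnit (bordered v μ A)) {x : Fin n → ℝ}
    (hx : A *ᵥ x = μ • x) : x = (v ⬝ᵥ x) • (bordered v μ A)⁻¹ *ᵥ v := by
  have hmul : bordered v μ A *ᵥ x = (v ⬝ᵥ x) • v := by
    rw [bordered_mulVec, hx, sub_self, zero_add]
  rw [← mulVec_smul, ← hmul, mulVec_mulVec, nonsing_inv_mul _ ((isUnit_iff_isUnit_det _).1 h),
    one_mulVec]

theorem vecMulVec_eq_smul_mul_inv_bordered (h : IsUnit (bordered v μ A)) (hA : A.IsSymm)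
    {x : Fin n → ℝ} (hx : A *ᵥ x = μ • x) (y : Fin n → ℝ) :
    vecMulVec y x = (v ⬝ᵥ x) • (vecMulVec y v * (bordered v μ A)⁻¹) := by
  conv_lhs => rw [eq_smul_inv_bordered_mulVec h hx]
  rw [vecMulVec_smul, vecMulVec_mul, ← mulVec_transpose, transpose_nonsing_inv,
    transpose_bordered hA]

theorem vecMulVec_self_eq_smul_inv_bordered (h : IsUnit (bordered v μ A)) (hA : A.IsSymm)
    {x : Fin n → ℝ} (hx : A *ᵥ x = μ • x) :
    vecMulVec x x = (v ⬝ᵥ x) ^ 2 •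
      ((bordered v μ A)⁻¹ * vecMulVec v v * (bordered v μ A)⁻¹) := by
  rw [vecMulVec_eq_smul_mul_inv_bordered h hA hx, ← transpose_vecMulVec v x,
    vecMulVec_eq_smul_mul_inv_bordered h hA hx, transpose_smul, transpose_mul,
    transpose_vecMulVec, transpose_nonsing_inv, transpose_bordered hA, smul_mul, smul_smul, sq]

end Bordered

theorem trace_ne_zero_and_eq_inv_trace_smul {c : ℝ} {P J : SqMat n} (hP : P.trace = 1)
    (hJ : P = c • J) : J.trace ≠ 0 ∧ P = J.trace⁻¹ • J := by
  rw [hJ, trace_smul, smul_eq_mul] at hP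
  exact ⟨right_ne_zero_of_mul_eq_one hP, by rw [hJ, eq_inv_of_mul_eq_one_left hP]⟩

theorem contDiffAt_inv_trace_smul {E : Type*} [NormedAddCommGroup E] [NormedSpace ℝ E]
    {m : WithTop ℕ∞} {J : E → SqMat n} {x : E} (hJ : ContDiffAt ℝ m J x) (h : (J x).trace ≠ 0) :
    ContDiffAt ℝ m (fun y => (J y).trace⁻¹ • J y) x :=
  (((traceLinearMap (Fin n) ℝ ℝ).toContinuousLinearMap.contDiff.contDiffAt.comp x hJ).inv h).smul hJ

theorem exists_contDiffAt_eq_eigproj {A₀ : SqMat n} (hA₀ : A₀.IsSymm) {j : ℕ} (h1 : 1 ≤ j)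
    (hn : j ≤ n) (hs : IsSimpleEigval A₀ j) {m : WithTop ℕ∞} :
    ∃ K : ℝ × SqMat n → SqMat n, ContDiffAt ℝ m K (eigval A₀ j, A₀) ∧
      ∀ᶠ p in 𝓝 (eigval A₀ j, A₀), p.2.IsSymm → p.1 = eigval p.2 j → eigproj p.2 j = K p := by
  set v := eigvec A₀ j
  set J : ℝ × SqMat n → SqMat n := fun p =>
    (bordered v p.1 p.2)⁻¹ * vecMulVec v v * (bordered v p.1 p.2)⁻¹
  have hU := isUnit_bordered_eigvec hA₀ h1 hn hs
  have hproj {A : SqMat n} (hA : A.IsSymm) (h : IsUnit (bordered v (eigval A j) A)) :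
      (J (eigval A j, A)).trace ≠ 0 ∧
        eigproj A j = (J (eigval A j, A)).trace⁻¹ • J (eigval A j, A) := by
    obtain ⟨hunit, heig⟩ := eigvec_spec hA h1 hn
    exact trace_ne_zero_and_eq_inv_trace_smul (by rw [eigproj, trace_vecMulVec, hunit])
      (vecMulVec_self_eq_smul_inv_bordered h hA heig)
  have hinv := contDiffAt_inv_bordered (m := m) hU
  refine ⟨_, contDiffAt_inv_trace_smul
    (contDiffAt_matrix_mul (contDiffAt_matrix_mul hinv contDiffAt_const) hinv)
    (hproj hA₀ hU).1, ?_⟩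
  have hcont : Continuous fun p : ℝ × SqMat n => bordered v p.1 p.2 := by
    unfold bordered
    fun_prop
  filter_upwards [hcont.continuousAt.eventually (eventually_isUnit_matrix hU)]
    with ⟨μ, A⟩ hμ hA hμA
  obtain rfl : μ = eigval A j := hμA
  exact (hproj hA hμ).2

theorem sub_mul_trace_vecMulVec {A B : SqMat n} (hA : A.IsSymm) {u w : Fin n → ℝ} {μ ν : ℝ}
    (hu : A *ᵥ u = μ • u) (hw : B *ᵥ w = ν • w) :
    (ν - μ) * (vecMulVec u w).trace = inner ℝ (vecMulVec u w) (B - A) := by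
  change _ = frobInner _ _
  rw [frobInner_vecMulVec, sub_mulVec, dotProduct_sub, hw, dotProduct_mulVec _ A,
    ← mulVec_transpose, hA.eq, hu, dotProduct_smul, smul_dotProduct, trace_vecMulVec, smul_eq_mul,
    smul_eq_mul, sub_mul]

theorem eigval_sub_eigval_eq_inner {A B : SqMat n} (hA : A.IsSymm) (hB : B.IsSymm) {j : ℕ}
    (h1 : 1 ≤ j) (hn : j ≤ n) (hU : IsUnit (bordered (eigvec A j) (eigval B j) B)) {J : SqMat n}
    (hJ : J = vecMulVec (eigvec A j) (eigvec A j) * (bordered (eigvec A j) (eigval B j) B)⁻¹)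
    (htr : J.trace ≠ 0) :
    eigval B j - eigval A j = inner ℝ (J.trace⁻¹ • J) (B - A) := by
  obtain ⟨hunit, heig⟩ := eigvec_spec hB h1 hn
  have hkey := sub_mul_trace_vecMulVec hA (eigvec_spec hA h1 hn).2 heig
  rw [vecMulVec_eq_smul_mul_inv_bordered hU hB heig, ← hJ, trace_smul, smul_eq_mul,
    real_inner_smul_left, mul_left_comm] at hkey
  have hoverlap : eigvec A j ⬝ᵥ eigvec B j ≠ 0 := by
    intro h0
    have := eq_smul_inv_bordered_mulVec hU heig
    rw [h0, zero_smul] at this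
    simp [this] at hunit
  rw [real_inner_smul_left, ← mul_left_cancel₀ hoverlap hkey, mul_comm,
    mul_inv_cancel_right₀ htr]

section Family

variable {X : Type*} [TopologicalSpace X] {M : X → SqMat n} {p : X} {j : ℕ}

theorem eventually_isUnit_bordered (hMs : ∀ q, (M q).IsSymm) (hM : ContinuousAt M p)
    {v : Fin n → ℝ} (h : IsUnit (bordered v (eigval (M p) j) (M p))) :
    ∀ᶠ q in 𝓝 p, IsUnit (bordered v (eigval (M q) j) (M q)) := by
  have hcont : ContinuousAt (fun q => bordered v (eigval (M q) j) (M q)) p := by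
    have := continuousAt_eigval hMs hM j
    unfold bordered
    fun_prop
  exact hcont.eventually (eventually_isUnit_matrix h)

theorem eventually_isSimpleEigval (hMs : ∀ q, (M q).IsSymm) (hM : ContinuousAt M p) (h1 : 1 ≤ j)
    (hn : j ≤ n) (hs : IsSimpleEigval (M p) j) : ∀ᶠ q in 𝓝 p, IsSimpleEigval (M q) j := by
  filter_upwards [eventually_isUnit_bordered hMs hM (isUnit_bordered_eigvec (hMs p) h1 hn hs)]
    with q hq
  exact isSimpleEigval_of_forall_exists_eq_smul (hMs q) h1 hn fun u hu =>
    ⟨_, eq_smul_inv_bordered_mulVec hq hu⟩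

theorem continuousAt_eigproj (hMs : ∀ q, (M q).IsSymm) (hM : ContinuousAt M p) (h1 : 1 ≤ j)
    (hn : j ≤ n) (hs : IsSimpleEigval (M p) j) : ContinuousAt (fun q => eigproj (M q) j) p := by
  obtain ⟨K, hK, hKeq⟩ := exists_contDiffAt_eq_eigproj (m := 0) (hMs p) h1 hn hs
  have hpair : ContinuousAt (fun q => (eigval (M q) j, M q)) p :=
    (continuousAt_eigval hMs hM j).prodMk hM
  refine (ContinuousAt.comp (f := fun q => (eigval (M q) j, M q)) hK.continuousAt hpair).congr ?_
  filter_upwards [hpair.eventually hKeq] with q hq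
  exact (hq (hMs q) rfl).symm

end Family

section Derivative

variable {E : Type*} [NormedAddCommGroup E] [NormedSpace ℝ E] {M : E → SqMat n} {p : E} {j : ℕ}

theorem hasFDerivAt_eigval (hMs : ∀ q, (M q).IsSymm) {M' : E →L[ℝ] SqMat n}
    (hM : HasFDerivAt M M' p) (h1 : 1 ≤ j) (hn : j ≤ n) (hs : IsSimpleEigval (M p) j) :
    HasFDerivAt (fun q => eigval (M q) j) ((innerSL ℝ (eigproj (M p) j)).comp M') p := by
  set v := eigvec (M p) j
  obtain ⟨hunit, heig⟩ := eigvec_spec (hMs p) h1 hn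
  have hU := isUnit_bordered_eigvec (hMs p) h1 hn hs
  set J : E → SqMat n := fun q => vecMulVec v v * (bordered v (eigval (M q) j) (M q))⁻¹
  have hJp : J p = vecMulVec v v := by
    have := vecMulVec_eq_smul_mul_inv_bordered hU (hMs p) heig v
    rwa [hunit, one_smul, eq_comm] at this
  have htr : (J p).trace = 1 := by rw [hJp, trace_vecMulVec, hunit]
  have hJc : ContinuousAt J p := by
    have hinv := ContinuousAt.comp (f := fun q => (eigval (M q) j, M q))
      (contDiffAt_inv_bordered (m := 0) hU).continuousAt
      ((continuousAt_eigval hMs hM.continuousAt j).prodMk hM.continuousAt)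
    exact ((LinearMap.mulLeft ℝ (vecMulVec v v)).continuous_of_finiteDimensional.continuousAt).comp
      hinv
  have htrc : ContinuousAt (fun q => (J q).trace) p :=
    (traceLinearMap (Fin n) ℝ ℝ).continuous_of_finiteDimensional.continuousAt.comp hJc
  have hslope : ∀ᶠ q in 𝓝 p, eigval (M q) j - eigval (M p) j =
      innerSL ℝ ((J q).trace⁻¹ • J q) (M q - M p) := by
    filter_upwards [eventually_isUnit_bordered hMs hM.continuousAt hU,
      htrc.eventually_ne (htr.trans_ne one_ne_zero)] with q hq hne
    exact eigval_sub_eigval_eq_inner (hMs p) (hMs q) h1 hn hq rfl hne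
  have hΦ : ContinuousAt (fun q => innerSL ℝ ((J q).trace⁻¹ • J q)) p :=
    (innerSL ℝ).continuous.continuousAt.comp
      ((htrc.inv₀ (htr.trans_ne one_ne_zero)).smul hJc)
  refine (hasFDerivAt_of_sub_eq_clm_apply_sub hM hΦ hslope).congr_fderiv ?_
  rw [htr, inv_one, one_smul, hJp, eigproj]

theorem contDiffAt_eigval (hMs : ∀ q, (M q).IsSymm) (hM : ContDiffAt ℝ 1 M p) (h1 : 1 ≤ j)
    (hn : j ≤ n) (hs : IsSimpleEigval (M p) j) :
    ContDiffAt ℝ 1 (fun q => eigval (M q) j) p := by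
  obtain ⟨M', u, hu, hM'c, hM'⟩ := contDiffAt_one_iff.1 hM
  have hsimple := eventually_isSimpleEigval hMs hM.continuousAt h1 hn hs
  obtain ⟨w, hw, hwo, hpw⟩ := mem_nhds_iff.1 (inter_mem hu hsimple)
  refine contDiffAt_one_iff.2 ⟨fun q => (innerSL ℝ (eigproj (M q) j)).comp (M' q), w,
    hwo.mem_nhds hpw, fun q hq => ?_,
    fun q hq => hasFDerivAt_eigval hMs (hM' q (hw hq).1) h1 hn (hw hq).2⟩
  have hproj := continuousAt_eigproj hMs (hM' q (hw hq).1).continuousAt h1 hn (hw hq).2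
  exact (((innerSL ℝ).continuous.continuousAt.comp hproj).continuousWithinAt).clm_comp
    ((hM'c q (hw hq).1).mono fun _ h => (hw h).1)

theorem contDiffAt_eigproj (hMs : ∀ q, (M q).IsSymm) (hM : ContDiffAt ℝ 1 M p) (h1 : 1 ≤ j)
    (hn : j ≤ n) (hs : IsSimpleEigval (M p) j) :
    ContDiffAt ℝ 1 (fun q => eigproj (M q) j) p := by
  obtain ⟨K, hK, hKeq⟩ := exists_contDiffAt_eq_eigproj (m := 1) (hMs p) h1 hn hs
  have hpair := (contDiffAt_eigval hMs hM h1 hn hs).prodMk hM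
  refine (hK.comp p hpair).congr_of_eventuallyEq ?_
  filter_upwards [hpair.continuousAt.eventually hKeq] with q hq
  exact hq (hMs q) rfl

end Derivative

end SimpleEigenvalue

section Laplacian

open Matrix

variable {n : ℕ}

/-- The graph Laplacian as a continuous linear map. -/
noncomputable def laplacianL (n : ℕ) : SqMat n →L[ℝ] SqMat n :=
  LinearMap.toContinuousLinearMap
    { toFun := laplacian
      map_add' := fun A B => by
        have hdiag : diagonal (A *ᵥ 1 + B *ᵥ 1) = diagonal (A *ᵥ 1) + diagonal (B *ᵥ 1) :=
          (diagonal_add _ _).symm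
        simp only [laplacian, add_mulVec, hdiag, add_sub_add_comm]
      map_smul' := fun c A => by
        simp only [laplacian, smul_mulVec, diagonal_smul, smul_sub, RingHom.id_apply] }

theorem laplacianL_apply (A : SqMat n) : laplacianL n A = laplacian A := rfl

theorem laplacian_isSymm {A : SqMat n} (h : A.IsSymm) : (laplacian A).IsSymm := by
  rw [Matrix.IsSymm, laplacian, transpose_sub, diagonal_transpose, h.eq]

/-- The adjoint of the graph Laplacian on the symmetric matrices. -/
noncomputable def laplacianAdjoint (n : ℕ) : SqMat n →ₗ[ℝ] SqMat n where
  toFun A := (2⁻¹ : ℝ) • (vecMulVec A.diag 1 + vecMulVec 1 A.diag) - A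
  map_add' A B := by
    rw [diag_add, add_vecMulVec, vecMulVec_add]
    module
  map_smul' c A := by
    rw [diag_smul, smul_vecMulVec, vecMulVec_smul, RingHom.id_apply]
    module

theorem frobInner_diagonal (A : SqMat n) (v : Fin n → ℝ) :
    frobInner A (diagonal v) = A.diag ⬝ᵥ v := by
  simp [frobInner_eq_sum, diagonal_apply, dotProduct]

theorem frobInner_laplacianAdjoint (A : SqMat n) {Z : SqMat n} (hZ : Z.IsSymm) :
    frobInner (laplacianAdjoint n A) Z = frobInner A (laplacian Z) := by
  let _ := frobeniusInnerProductSpace n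
  have hdZ : 1 ⬝ᵥ Z *ᵥ A.diag = A.diag ⬝ᵥ Z *ᵥ 1 := by
    rw [dotProduct_mulVec, ← mulVec_transpose, hZ.eq, dotProduct_comm]
  calc frobInner (laplacianAdjoint n A) Z
      = 2⁻¹ * (A.diag ⬝ᵥ Z *ᵥ 1 + 1 ⬝ᵥ Z *ᵥ A.diag) - frobInner A Z := by
        rw [← frobInner_vecMulVec, ← frobInner_vecMulVec]
        change inner ℝ ((2⁻¹ : ℝ) • (_ + _) - A) Z = _
        rw [inner_sub_left, real_inner_smul_left, inner_add_left]
        rfl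
    _ = A.diag ⬝ᵥ Z *ᵥ 1 - frobInner A Z := by rw [hdZ]; ring
    _ = frobInner A (diagonal (Z *ᵥ 1)) - frobInner A Z := by rw [frobInner_diagonal]
    _ = frobInner A (laplacian Z) := (inner_sub_right (𝕜 := ℝ) A (diagonal (Z *ᵥ 1)) Z).symm

end Laplacian

namespace WeightedGraph

section Gradient

attribute [local instance] frobeniusInnerProductSpace

open Matrix

variable {n : ℕ} (G : WeightedGraph n) (k : ℕ) (ε : ℝ)

theorem R_eq (E : SqMat n) :
    G.R k ε E = laplacianAdjoint n (eigproj (G.lap ε E) (k + 1) - eigproj (G.lap ε E) k) := by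
  have hdiag (x y : Fin n → ℝ) : (vecMulVec x x - vecMulVec y y).diag = x * x - y * y := rfl
  simp only [R, laplacianAdjoint, eigproj, LinearMap.coe_mk, AddHom.coe_mk, hdiag]
  module

theorem R_isSymm (E : SqMat n) : (G.R k ε E).IsSymm := by
  simp [Matrix.IsSymm, R, transpose_vecMulVec, add_comm]

theorem rank_R_le (E : SqMat n) : (G.R k ε E).rank ≤ 4 := by
  set x := eigvec (G.lap ε E) (k + 1) with hx
  set y := eigvec (G.lap ε E) k with hy
  set z := x * x - y * y with hz
  have hR : G.R k ε E = vecMulVec ((2⁻¹ : ℝ) • z) 1 + vecMulVec ((2⁻¹ : ℝ) • 1) z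
      + vecMulVec (-x) x + vecMulVec y y := by
    simp only [R, ← hx, ← hy, ← hz, smul_vecMulVec, neg_vecMulVec]
    module
  have hrank_add {A : SqMat n} {r : ℕ} (hA : A.rank ≤ r) (u v : Fin n → ℝ) :
      (A + vecMulVec u v).rank ≤ r + 1 :=
    (matrix_rank_add_le _ _).trans (add_le_add hA (rank_vecMulVec_le u v))
  rw [hR]
  exact hrank_add (hrank_add (hrank_add (rank_vecMulVec_le _ _) _ _) _ _) _ _

/-- The symmetric matrices that vanish outside the edge set: the subspace containing the sphere
`E₁`, on which the spectral gap is minimized. -/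
def symPattern : Submodule ℝ (SqMat n) where
  carrier := {E | E.IsSymm ∧ ∀ i j, (i, j) ∉ G.edges → E i j = 0}
  add_mem' hA hB := ⟨hA.1.add hB.1, fun i j h => by simp [hA.2 i j h, hB.2 i j h]⟩
  zero_mem' := ⟨isSymm_zero, fun _ _ _ => rfl⟩
  smul_mem' c _ hA := ⟨hA.1.smul c, fun i j h => by simp [hA.2 i j h]⟩

theorem patProj_mem_symPattern {A : SqMat n} (hA : A.IsSymm) : G.patProj A ∈ G.symPattern := by
  refine ⟨IsSymm.ext fun i j => ?_, fun i j hij => by simp [patProj, hij]⟩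
  have hedges : (j, i) ∈ G.edges ↔ (i, j) ∈ G.edges := ⟨G.edges_symm j i, G.edges_symm i j⟩
  by_cases hij : (i, j) ∈ G.edges <;> simp [patProj, hA.apply i j, hedges, hij]

/-- The orthogonal projection onto `symPattern`. On symmetric matrices it agrees with `patProj`. -/
noncomputable def symProj : SqMat n →L[ℝ] G.symPattern := G.symPattern.orthogonalProjectionOnto

theorem coe_symProj {A : SqMat n} (hA : A.IsSymm) :
    (G.symProj A : SqMat n) = G.patProj A := by
  refine Submodule.eq_starProjection_of_mem_of_inner_eq_zero (G.patProj_mem_symPattern hA)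
    fun B hB => ?_
  change frobInner (A - G.patProj A) B = 0
  rw [frobInner_eq_sum]
  refine Finset.sum_eq_zero fun i _ => Finset.sum_eq_zero fun j _ => ?_
  by_cases hij : (i, j) ∈ G.edges
  · simp [patProj, hij]
  · simp [hB.2 i j hij]

theorem inner_symProj (A : SqMat n) (D : G.symPattern) :
    inner ℝ (G.symProj A) D = frobInner A D :=
  Submodule.inner_orthogonalProjectionOnto_eq_of_mem_right D A

variable {G k ε}

theorem lap_isSymm (E : G.symPattern) : (G.lap ε E).IsSymm :=
  laplacian_isSymm (G.weight_symm.add (E.2.1.smul ε))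

theorem lap_eq (E : SqMat n) : G.lap ε E = laplacianL n G.weight + ε • laplacianL n E := by
  rw [lap, ← laplacianL_apply, map_add, map_smul]

theorem hasFDerivAt_lap (E : G.symPattern) :
    HasFDerivAt (fun E : G.symPattern => G.lap ε E)
      (ε • (laplacianL n).comp G.symPattern.subtypeL) E := by
  simp only [lap_eq]
  exact (ε • (laplacianL n).comp G.symPattern.subtypeL).hasFDerivAt.const_add _

theorem contDiff_lap {m : WithTop ℕ∞} : ContDiff ℝ m fun E : G.symPattern => G.lap ε E := by
  simp only [lap_eq]
  exact contDiff_const.add (ε • (laplacianL n).comp G.symPattern.subtypeL).contDiff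

theorem hasFDerivAt_gap {E : G.symPattern} (hk : 1 ≤ k) (hkn : k + 1 ≤ n)
    (hsimple_k : IsSimpleEigval (G.lap ε E) k)
    (hsimple_k1 : IsSimpleEigval (G.lap ε E) (k + 1)) :
    HasFDerivAt (fun E : G.symPattern => G.gap k ε E)
      (ε • innerSL ℝ (G.symProj (G.R k ε E))) E := by
  have hlap := hasFDerivAt_lap (ε := ε) E
  refine ((hasFDerivAt_eigval lap_isSymm hlap (Nat.le_add_left 1 k) hkn hsimple_k1).sub
    (hasFDerivAt_eigval lap_isSymm hlap hk (by omega) hsimple_k)).congr_fderiv ?_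
  ext D
  change inner ℝ (eigproj (G.lap ε E) (k + 1)) (ε • laplacian (D : SqMat n))
    - inner ℝ (eigproj (G.lap ε E) k) (ε • laplacian (D : SqMat n))
    = ε * inner ℝ (G.symProj (G.R k ε E)) D
  rw [← inner_sub_left, real_inner_smul_right, inner_symProj, R_eq,
    frobInner_laplacianAdjoint _ D.2.1]
  rfl

theorem eventually_hasFDerivAt_gap {E₀ : G.symPattern} (hk : 1 ≤ k) (hkn : k + 1 ≤ n)
    (hsimple_k : IsSimpleEigval (G.lap ε E₀) k)
    (hsimple_k1 : IsSimpleEigval (G.lap ε E₀) (k + 1)) :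
    ∀ᶠ E : G.symPattern in 𝓝 E₀, HasFDerivAt (fun E : G.symPattern => G.gap k ε E)
      (ε • innerSL ℝ (G.symProj (G.R k ε E))) E := by
  have hlap := (hasFDerivAt_lap (ε := ε) E₀).continuousAt
  filter_upwards [eventually_isSimpleEigval lap_isSymm hlap hk (by omega) hsimple_k,
    eventually_isSimpleEigval lap_isSymm hlap (Nat.le_add_left 1 k) hkn hsimple_k1] with E h h'
  exact hasFDerivAt_gap hk hkn h h'

theorem contDiffAt_R {E₀ : G.symPattern} (hk : 1 ≤ k) (hkn : k + 1 ≤ n)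
    (hsimple_k : IsSimpleEigval (G.lap ε E₀) k)
    (hsimple_k1 : IsSimpleEigval (G.lap ε E₀) (k + 1)) :
    ContDiffAt ℝ 1 (fun E : G.symPattern => G.R k ε E) E₀ := by
  have hlap := (contDiff_lap (G := G) (ε := ε) (m := 1)).contDiffAt (x := E₀)
  simp only [R_eq]
  exact (laplacianAdjoint n).toContinuousLinearMap.contDiff.contDiffAt.comp E₀
    ((contDiffAt_eigproj lap_isSymm hlap (Nat.le_add_left 1 k) hkn hsimple_k1).sub
      (contDiffAt_eigproj lap_isSymm hlap hk (by omega) hsimple_k))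

end Gradient

end WeightedGraph

section TangentProjError

variable {n : ℕ}

theorem eq_smul_of_tangentProj_eq_smul {Y A : SqMat n} {μ : ℝ} (hY : Y.IsSymm) (hA : A.IsSymm)
    (hr : A.rank ≤ Y.rank) (hμ : μ ≠ 0) (h : tangentProj Y A = μ • Y) : A = μ • Y := by
  have hPA : rangeProj Y * A = μ • Y := by
    rw [← rangeProj_mul_self Y, ← Matrix.mul_smul, ← h, rangeProj_mul_self, tangentProj, mul_sub,
      Matrix.mul_assoc (1 - _), ← Matrix.mul_assoc, mul_sub, mul_one, rangeProj_mul_rangeProj,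
      sub_self, zero_mul, sub_zero]
  have hAP : A * rangeProj Y = μ • Y := by
    have htranspose := congrArg Matrix.transpose hPA
    rwa [Matrix.transpose_mul, rangeProj_transpose, hA.eq, Matrix.transpose_smul, hY.eq]
      at htranspose
  have hrank : A.rank ≤ (A * rangeProj Y).rank := by
    rwa [hAP, Matrix.rank_smul_of_mem_nonZeroDivisors _ (mem_nonZeroDivisors_of_ne_zero hμ)]
  have hrange : rangeProj A = rangeProj Y := by
    rw [← rangeProj_mul_of_rank_le hrank, hAP, rangeProj_smul hμ]
  rw [← hPA, ← hrange, rangeProj_mul_self]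

theorem sub_tangentProj_isLittleO {A : SqMat n → SqMat n} {Z : SqMat n}
    (hA : DifferentiableAt ℝ A Z) (hAZ : A Z = Z) (hrank : ∀ Y, (A Y).rank ≤ Z.rank) :
    (fun Y => A Y - tangentProj Y (A Y)) =o[𝓝[{Y | Y.rank ≤ Z.rank}] Z] fun Y => Y - Z := by
  have hsub : (fun Y => A Y - Y) =O[𝓝[{Y | Y.rank ≤ Z.rank}] Z] fun Y => Y - Z := by
    have hdiff := hA.isBigO_sub.sub (Asymptotics.isBigO_refl (fun Y => Y - Z) (𝓝 Z))
    exact (hdiff.mono nhdsWithin_le_nhds).congr_left fun Y => by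
      rw [hAZ, sub_sub_sub_cancel_right]
  have htendsto : Tendsto (fun Y => (Y, A Y)) (𝓝[{Y | Y.rank ≤ Z.rank}] Z)
      (𝓝[{Y | Y.rank ≤ Z.rank} ×ˢ {A | A.rank ≤ Z.rank}] (Z, Z)) := by
    have hpair := continuousAt_id.prodMk hA.continuousAt
    rw [ContinuousAt, id, hAZ] at hpair
    exact tendsto_nhdsWithin_iff.2 ⟨hpair.mono_left nhdsWithin_le_nhds,
      eventually_mem_nhdsWithin.mono fun Y hY => ⟨hY, hrank Y⟩⟩
  have hsmall : (fun Y => ‖Y - Z‖ ^ 2) =o[𝓝[{Y | Y.rank ≤ Z.rank}] Z] fun Y => Y - Z :=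
    (Asymptotics.isLittleO_pow_sub_sub Z one_lt_two).mono nhdsWithin_le_nhds
  exact (((sub_tangentProj_isBigO Z).comp_tendsto htendsto).trans
    (hsub.norm_norm.pow 2)).trans_isLittleO hsmall

end TangentProjError

namespace WeightedGraph

section LowRankField

attribute [local instance] frobeniusInnerProductSpace

open Matrix

variable {n : ℕ} {G : WeightedGraph n} {k : ℕ} {ε : ℝ} {Z : SqMat n}

theorem exists_R_eq_smul (hZ : Z ∈ symRankFour n) (hstat : G.lowRankField k ε Z = 0)
    (hR : tangentProj Z (G.R k ε (G.patProj Z)) ≠ 0) :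
    ∃ μ : ℝ, μ ≠ 0 ∧ G.R k ε (G.patProj Z) = μ • Z := by
  have htangent := (sub_eq_zero.1 hstat).symm
  refine ⟨_, fun hμ => hR ?_, eq_smul_of_tangentProj_eq_smul hZ.2 (G.R_isSymm k ε _)
    (hZ.1 ▸ G.rank_R_le k ε _) (fun hμ => hR ?_) htangent⟩ <;>
  rw [htangent, hμ, zero_smul]

theorem symProj_lowRankField {Y : SqMat n} (hY : Y.IsSymm) :
    G.symProj (G.lowRankField k ε Y) =
      inner ℝ (G.symProj (tangentProj Y (G.R k ε (G.symProj Y)))) (G.symProj Y) • G.symProj Y -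
        G.symProj (tangentProj Y (G.R k ε (G.symProj Y))) := by
  rw [inner_symProj, ← map_smul, ← map_sub, G.coe_symProj hY]
  rfl

theorem R_sub_tangentProj_isLittleO {μ : ℝ} (hμ : μ ≠ 0) (hZ : Z ∈ symRankFour n)
    (hR : ContDiffAt ℝ 1 (fun E : G.symPattern => G.R k ε E) (G.symProj Z))
    (hRZ : G.R k ε (G.symProj Z) = μ • Z) :
    (fun Y => G.R k ε (G.symProj Y) - tangentProj Y (G.R k ε (G.symProj Y)))
      =o[𝓝[symRankFour n] Z] fun Y => Y - Z := by
  have hdiff : DifferentiableAt ℝ (fun Y => μ⁻¹ • G.R k ε (G.symProj Y)) Z :=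
    ((hR.differentiableAt one_ne_zero).comp Z G.symProj.differentiableAt).const_smul μ⁻¹
  have hrank (Y : SqMat n) : (μ⁻¹ • G.R k ε (G.symProj Y)).rank ≤ Z.rank := by
    rw [rank_smul_of_mem_nonZeroDivisors _ (mem_nonZeroDivisors_of_ne_zero (inv_ne_zero hμ)), hZ.1]
    exact G.rank_R_le k ε _
  have hsub := sub_tangentProj_isLittleO hdiff (by rw [hRZ, inv_smul_smul₀ hμ]) hrank
  simp only [tangentProj_smul, ← smul_sub] at hsub
  refine ((Asymptotics.isLittleO_const_smul_left (inv_ne_zero hμ)).1 hsub).mono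
    (nhdsWithin_mono Z fun Y hY => ?_)
  exact (hY.1.trans hZ.1.symm).le

theorem exists_contDiffAt_lowRankField_eq
    (hR : ContDiffAt ℝ 1 (fun E : G.symPattern => G.R k ε E) (G.symProj Z)) :
    ∃ C : SqMat n → SqMat n, ContDiffAt ℝ 1 C Z ∧ ∀ᶠ Y in 𝓝 Z, Y.IsSymm → Y.rank = Z.rank →
      G.lowRankField k ε Y = C Y * Y + Y * (C Y)ᵀ := by
  obtain ⟨X, hX, hYX⟩ := exists_contDiffAt_mul_eq_rangeProj (m := 1) Z
  set D : SqMat n → SqMat n := fun Y =>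
    (1 - (2⁻¹ : ℝ) • (Y * X Y)) * G.R k ε (G.symProj Y) * (X Y)ᵀ
  set a : SqMat n → ℝ := fun Y => inner ℝ (D Y * Y + Y * (D Y)ᵀ) (G.symProj Y : SqMat n)
  have hDcont : ContDiffAt ℝ 1 D Z :=
    contDiffAt_matrix_mul (contDiffAt_matrix_mul
      (contDiffAt_const.sub ((contDiffAt_matrix_mul contDiffAt_id hX).const_smul _))
      (hR.comp Z G.symProj.contDiff.contDiffAt)) (contDiffAt_matrix_transpose hX)
  have hacont : ContDiffAt ℝ 1 a Z :=
    ((contDiffAt_matrix_mul hDcont contDiffAt_id).add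
      (contDiffAt_matrix_mul contDiffAt_id (contDiffAt_matrix_transpose hDcont))).inner ℝ
      (G.symPattern.subtypeL.comp G.symProj).contDiff.contDiffAt
  refine ⟨fun Y => (a Y / 2) • 1 - D Y,
    ((hacont.div_const 2).smul contDiffAt_const).sub hDcont, ?_⟩
  filter_upwards [hYX] with Y hY hYs hYr
  have htangent : tangentProj Y (G.R k ε (G.symProj Y)) = D Y * Y + Y * (D Y)ᵀ := by
    simp only [D, hY hYr.le]
    exact tangentProj_eq_mul_add_mul_transpose hYs (G.R_isSymm k ε _) (hY hYr.le)
  have hfield : G.lowRankField k ε Y = a Y • Y - (D Y * Y + Y * (D Y)ᵀ) := by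
    simp only [a, ← htangent, G.coe_symProj hYs]
    rfl
  rw [hfield, transpose_sub, transpose_smul, transpose_one, sub_mul, mul_sub, Matrix.smul_mul,
    Matrix.mul_smul, one_mul, mul_one]
  module

theorem IsLowRankSolution.isSolutionWhileIn {Y : ℝ → SqMat n} (hY : G.IsLowRankSolution k ε Y)
    (U : Set (SqMat n)) : IsSolutionWhileIn (G.lowRankField k ε) (symRankFour n) U Y :=
  ⟨fun t ht => (hY t ht).2.continuousWithinAt, fun t ht _ => hY t ht⟩

theorem exists_isSolutionWhileIn_lowRankField (hk : 1 ≤ k) (hkn : k + 1 ≤ n)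
    (hZ : Z ∈ symRankFour n) (hsimple_k : IsSimpleEigval (G.lap ε (G.patProj Z)) k)
    (hsimple_k1 : IsSimpleEigval (G.lap ε (G.patProj Z)) (k + 1)) :
    ∃ U ∈ 𝓝 Z, ∀ Y₀ ∈ symRankFour n, ∃ Y : ℝ → SqMat n, Y 0 = Y₀ ∧
      IsSolutionWhileIn (G.lowRankField k ε) (symRankFour n) U Y := by
  rw [← G.coe_symProj hZ.2] at hsimple_k hsimple_k1
  obtain ⟨C, hC, hfield⟩ :=
    exists_contDiffAt_lowRankField_eq (contDiffAt_R hk hkn hsimple_k hsimple_k1)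
  obtain ⟨U, hU, hsol⟩ := exists_isSolutionWhileIn_of_eq_mul_add_mul_transpose hC hfield
  rw [hZ.1] at hsol
  exact ⟨U, hU, fun Y₀ hY₀ => hsol Y₀ hY₀.2 hY₀.1⟩

theorem norm_symProj {Y : SqMat n} (hY : Y.IsSymm) : ‖G.symProj Y‖ = ‖G.patProj Y‖ := by
  rw [← G.coe_symProj hY]
  rfl

theorem norm_symProj_sub {Y : SqMat n} (hY : Y.IsSymm) (hZ : Z.IsSymm) :
    ‖G.symProj Y - G.symProj Z‖ = ‖G.patProj Y - G.patProj Z‖ := by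
  rw [← G.coe_symProj hY, ← G.coe_symProj hZ]
  rfl

theorem isStrongLocalMinOn_gap_symPattern (hZ : Z.IsSymm)
    (hmin : IsStrongLocalMinOn (G.gap k ε) G.unitSphere (G.patProj Z)) :
    IsStrongLocalMinOn (fun E : G.symPattern => G.gap k ε E) (Metric.sphere 0 1) (G.symProj Z) := by
  rw [← G.coe_symProj hZ] at hmin
  obtain ⟨hmem, α, hα, r, hr, hgrowth⟩ := hmin
  refine ⟨mem_sphere_zero_iff_norm.2 hmem.2.2, α, hα, r, hr, fun E hE hEr => ?_⟩
  exact hgrowth E ⟨E.2.1, E.2.2, mem_sphere_zero_iff_norm.1 hE⟩ hEr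

theorem exists_exponential_decay_lowRankField (hε : 0 < ε) (hk : 1 ≤ k) (hkn : k + 1 ≤ n)
    (hZ : Z ∈ symRankFour n) (hsimple_k : IsSimpleEigval (G.lap ε (G.patProj Z)) k)
    (hsimple_k1 : IsSimpleEigval (G.lap ε (G.patProj Z)) (k + 1))
    (hstat : G.lowRankField k ε Z = 0) (hPR : tangentProj Z (G.R k ε (G.patProj Z)) ≠ 0)
    (hmin : IsStrongLocalMinOn (G.gap k ε) G.unitSphere (G.patProj Z))
    (hproj : (fun Y => Y - Z) =O[𝓝[symRankFour n] Z] fun Y => G.patProj Y - G.patProj Z)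
    {U : Set (SqMat n)} (hU : U ∈ 𝓝 Z) :
    ∃ c > 0, ∃ C > 0, ∀ᶠ Y₀ in 𝓝 Z, Y₀ ∈ symRankFour n → ‖G.patProj Y₀‖ = 1 →
      ∀ Y, IsSolutionWhileIn (G.lowRankField k ε) (symRankFour n) U Y → Y 0 = Y₀ →
      (∀ t, 0 ≤ t → Y t ∈ U) ∧ (∀ t, 0 ≤ t → ‖Y t - Z‖ ≤ C * Real.exp (-c * t)) ∧
      AntitoneOn (fun t => G.gap k ε (G.patProj (Y t))) (Ici 0) ∧
      ∀ t, 0 ≤ t →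
        |G.gap k ε (G.patProj (Y t)) - G.gap k ε (G.patProj Z)| ≤ C * Real.exp (-c * t) := by
  have hmin' := isStrongLocalMinOn_gap_symPattern hZ.2 hmin
  obtain ⟨μ, hμ, hRZ⟩ := exists_R_eq_smul hZ hstat hPR
  rw [← G.coe_symProj hZ.2] at hsimple_k hsimple_k1 hRZ
  have hR := contDiffAt_R hk hkn hsimple_k hsimple_k1
  have hproj' : (fun Y => Y - Z) =O[𝓝[symRankFour n] Z] fun Y => G.symProj Y - G.symProj Z := by
    refine hproj.trans (Asymptotics.IsBigO.of_bound' ?_)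
    filter_upwards [self_mem_nhdsWithin] with Y hY using (norm_symProj_sub hY.2 hZ.2).ge
  have hgrad : (fun Y => G.symProj (G.R k ε (G.symProj Y)) -
      G.symProj (tangentProj Y (G.R k ε (G.symProj Y))))
      =o[𝓝[symRankFour n] Z] fun Y => G.symProj Y - G.symProj Z := by
    refine (((G.symProj.isBigO_comp _ _).trans_isLittleO
      (R_sub_tangentProj_isLittleO hμ hZ hR hRZ)).trans_isBigO hproj').congr_left fun Y => ?_
    exact map_sub G.symProj _ _
  obtain ⟨c, hc, C, hC, hdecay⟩ := exists_exponential_decay_of_isStrongLocalMinOn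
    (v := G.lowRankField k ε) (g := fun E : G.symPattern => G.symProj (G.R k ε E)) hε
    (eventually_mem_nhdsWithin.mono fun Y hY => symProj_lowRankField hY.2) hgrad hproj'
    (eventually_hasFDerivAt_gap hk hkn hsimple_k hsimple_k1)
    (G.symProj.hasFDerivAt.comp _ (hR.differentiableAt one_ne_zero).hasFDerivAt)
    ((congrArg G.symProj hRZ).trans (map_smul G.symProj μ Z)) hmin' hU
  refine ⟨c, hc, C, hC, hdecay.mono fun Y₀ hY₀ hY₀M hnorm Y hY hY0 => ?_⟩
  obtain ⟨hYU, hYZ, hanti, hgap⟩ := hY₀ ((norm_symProj hY₀M.2).trans hnorm) Y hY hY0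
  have hcoe : ∀ t, 0 ≤ t → G.gap k ε (G.symProj (Y t)) = G.gap k ε (G.patProj (Y t)) :=
    fun t ht => congrArg (G.gap k ε) (G.coe_symProj (hY.2 t ht (hYU t ht)).1.2)
  refine ⟨hYU, hYZ, hanti.congr hcoe, fun t ht => ?_⟩
  rw [← hcoe t ht, ← G.coe_symProj hZ.2]
  exact hgap t ht

end LowRankField

end WeightedGraph

theorem WeightedGraph.continuous_patProj {n : ℕ} (G : WeightedGraph n) : Continuous G.patProj := by
  refine continuous_matrix fun i j => ?_
  by_cases hij : (i, j) ∈ G.edges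
  · simpa [WeightedGraph.patProj, hij] using continuous_id.matrix_elem i j
  · simpa [WeightedGraph.patProj, hij] using continuous_const

theorem IsDiffeoOntoImage.sub_isBigO {V : Type*} [NormedAddCommGroup V] [NormedSpace ℝ V]
    {f : V → V} {X : Set V} (hf : IsDiffeoOntoImage f X) {x : V} (hx : x ∈ X)
    (hfx : ContinuousAt f x) : (fun y => y - x) =O[𝓝[X] x] fun y => f y - f x := by
  obtain ⟨-, g, hg, hgf⟩ := hf
  obtain ⟨O, h, hO, hxO, hh, hhg⟩ := hg (f x) (mem_image_of_mem f hx)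
  have hhf : ∀ y ∈ X, f y ∈ O → h (f y) = y := fun y hy hyO => by
    rw [hhg _ ⟨mem_image_of_mem f hy, hyO⟩, hgf hy]
  have hdiff : DifferentiableAt ℝ h (f x) :=
    (hh.contDiffAt (hO.mem_nhds hxO)).differentiableAt (by simp)
  refine ((hdiff.isBigO_sub.comp_tendsto hfx).mono nhdsWithin_le_nhds).congr' ?_ .rfl
  filter_upwards [self_mem_nhdsWithin,
    mem_nhdsWithin_of_mem_nhds (hfx.eventually (hO.mem_nhds hxO))] with y hy hyO
  simp only [Function.comp_apply, hhf y hy hyO, hhf x hx hxO]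

theorem WeightedGraph.sub_isBigO_patProj_sub {n : ℕ} (G : WeightedGraph n) {Z : SqMat n}
    (hZ : Z ∈ symRankFour n) {U : Set (SqMat n)} (hU : U ∈ 𝓝 Z)
    (hdiffeo : IsDiffeoOntoImage G.patProj ({Y | Y.rank = 4} ∩ U)) :
    (fun Y => Y - Z) =O[𝓝[symRankFour n] Z] fun Y => G.patProj Y - G.patProj Z := by
  refine (hdiffeo.sub_isBigO ⟨hZ.1, mem_of_mem_nhds hU⟩
    G.continuous_patProj.continuousAt).mono (nhdsWithin_le_iff.2 ?_)
  exact inter_mem (mem_of_superset self_mem_nhdsWithin fun _ hY => hY.1)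
    (mem_nhdsWithin_of_mem_nhds hU)

end LowRankFlow

open LowRankFlow in
theorem mainTheorem2_general {n : ℕ} (G : WeightedGraph n) (k : ℕ) (hk : 1 ≤ k) (hkn : k + 1 ≤ n)
    (ε : ℝ) (hε : 0 < ε) (Ystar : Matrix (Fin n) (Fin n) ℝ) (hY : Ystar ∈ symRankFour n)
    (hsimple_k : IsSimpleEigval (G.lap ε (G.patProj Ystar)) k)
    (hsimple_k1 : IsSimpleEigval (G.lap ε (G.patProj Ystar)) (k + 1))
    (hstat : G.lowRankField k ε Ystar = 0)
    (hPR : tangentProj Ystar (G.R k ε (G.patProj Ystar)) ≠ 0)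
    (hmin : IsStrongLocalMinOn (G.gap k ε) G.unitSphere (G.patProj Ystar))
    (hproj : (fun Y => Y - Ystar) =O[𝓝[symRankFour n] Ystar]
      fun Y => G.patProj Y - G.patProj Ystar) :
    ∃ δ > 0, ∃ C > 0, ∃ c > 0, ∀ Y₀ ∈ symRankFour n, ‖G.patProj Y₀‖ = 1 → ‖Y₀ - Ystar‖ < δ →
      (∃ Y : ℝ → Matrix (Fin n) (Fin n) ℝ, G.IsLowRankSolution k ε Y ∧ Y 0 = Y₀) ∧
      ∀ Y : ℝ → Matrix (Fin n) (Fin n) ℝ, G.IsLowRankSolution k ε Y → Y 0 = Y₀ →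
        (∀ t, 0 ≤ t → ‖Y t - Ystar‖ ≤ C * Real.exp (-c * t)) ∧
        AntitoneOn (fun t => G.gap k ε (G.patProj (Y t))) (Ici 0) ∧
        ∀ t, 0 ≤ t →
          |G.gap k ε (G.patProj (Y t)) - G.gap k ε (G.patProj Ystar)| ≤ C * Real.exp (-c * t) := by
  obtain ⟨U, hU, hexists⟩ :=
    WeightedGraph.exists_isSolutionWhileIn_lowRankField hk hkn hY hsimple_k hsimple_k1
  obtain ⟨c, hc, C, hC, hdecay⟩ := WeightedGraph.exists_exponential_decay_lowRankField hε hk hkn hY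
    hsimple_k hsimple_k1 hstat hPR hmin hproj hU
  obtain ⟨δ, hδ, hball⟩ := Metric.eventually_nhds_iff.1 hdecay
  refine ⟨δ, hδ, C, hC, c, hc, fun Y₀ hY₀ hnorm hY₀δ => ?_⟩
  have hdecay₀ := hball (by rwa [dist_eq_norm]) hY₀ hnorm
  constructor
  · obtain ⟨Y, hY0, hsol⟩ := hexists Y₀ hY₀
    exact ⟨Y, fun t ht => hsol.2 t ht ((hdecay₀ Y hsol hY0).1 t ht), hY0⟩
  · exact fun Y hsol hY0 => (hdecay₀ Y (hsol.isSolutionWhileIn U) hY0).2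

theorem mainTheorem2 {n : ℕ} (G : LowRankFlow.WeightedGraph n)
    (k : ℕ) (hk : 2 ≤ k) (hkn : k + 1 ≤ n) (ε : ℝ) (hε : 0 < ε)
    (Ystar : Matrix (Fin n) (Fin n) ℝ) (hY : Ystar ∈ LowRankFlow.symRankFour n)
    (hnorm : ‖G.patProj Ystar‖ = 1)
    (hsimple_k : LowRankFlow.IsSimpleEigval (G.lap ε (G.patProj Ystar)) k)
    (hsimple_k1 : LowRankFlow.IsSimpleEigval (G.lap ε (G.patProj Ystar)) (k + 1))
    (hstat : G.lowRankField k ε Ystar = 0)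
    (hPR : LowRankFlow.tangentProj Ystar (G.R k ε (G.patProj Ystar)) ≠ 0)
    (hmin : LowRankFlow.IsStrongLocalMinOn (G.gap k ε) G.unitSphere (G.patProj Ystar))
    (U : Set (Matrix (Fin n) (Fin n) ℝ)) (hU : IsOpen U) (hYU : Ystar ∈ U)
    (hdiffeo : LowRankFlow.IsDiffeoOntoImage G.patProj
      ({Y : Matrix (Fin n) (Fin n) ℝ | Y.rank = 4} ∩ U)) :
    ∃ δ > 0, ∃ C > 0, ∃ c > 0, ∀ Y₀ ∈ LowRankFlow.symRankFour n,
      ‖G.patProj Y₀‖ = 1 → ‖Y₀ - Ystar‖ < δ →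
      (∃ Y : ℝ → Matrix (Fin n) (Fin n) ℝ, G.IsLowRankSolution k ε Y ∧ Y 0 = Y₀) ∧
      ∀ Y : ℝ → Matrix (Fin n) (Fin n) ℝ, G.IsLowRankSolution k ε Y → Y 0 = Y₀ →
        (∀ t, 0 ≤ t → ‖Y t - Ystar‖ ≤ C * Real.exp (-c * t)) ∧
        AntitoneOn (fun t => G.gap k ε (G.patProj (Y t))) (Set.Ici 0) ∧
        (∀ t, 0 ≤ t →
          |G.gap k ε (G.patProj (Y t)) - G.gap k ε (G.patProj Ystar)| ≤ C * Real.exp (-c * t)) :=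
  mainTheorem2_general G k (by omega) hkn ε hε Ystar hY hsimple_k hsimple_k1 hstat hPR hmin
    (G.sub_isBigO_patProj_sub hY (hU.mem_nhds hYU) hdiffeo)
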